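/- Let $M>1$, $M_1,M_2>0$, $c<1/2$ and $\alpha\in(0,1/4)$ be constants. For $\theta=(\beta,\boldsymbol\gamma,\boldsymbol\Sigma,\sigma)$ with $\beta\in\mathbb R$, $\boldsymbol\gamma\in\mathbb R^{p-1}$, $\boldsymbol\Sigma\in\mathbb R^{p\times p}$ symmetric and $\sigma\ge 0$, let the data $D=\{(y_i,Z_i,\mathbf W_i)\}_{i=1}^n$ be i.i.d. under $\mathbb P_\theta$ with $(Z_i,\mathbf W_i^\top)^\top\sim\mathcal N_p(0,\boldsymbol\Sigma)$ and $y_i=Z_i\beta+\mathbf W_i^\top\boldsymbol\gamma+\varepsilon_i$, where $\varepsilon_i\sim\mathcal N(0,\sigma^2)$ is independent of $(Z_i,\mathbf W_i)$. Let $\boldsymbol\Omega=\boldsymbol\Sigma^{-1}$ with first row $\boldsymbol\Omega_{1,}$, let $\|\cdot\|_0$ be the number of nonzero entries, and let $\Theta(s)$ be the set of all $\theta$ such that $M^{-1}\le\lambda_{\min}(\boldsymbol\Sigma)\le\lambda_{\max}(\boldsymbol\Sigma)\le M$, the submatrix of $\boldsymbol\Sigma$ without its first row and column is the identity $\mathbb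 I_{p-1}$, $0\le\sigma\le M_1$, $\|(\beta,\boldsymbol\gamma^\top)\|_2\le M_2$ and $\|\boldsymbol\Omega_{1,}\|_0\le s$. Let $\mathcal C_\alpha(\Theta(s))$ be the set of all confidence intervals $[l(D),u(D)]$ with $\inf_{\theta\in\Theta(s)}\mathbb P_\theta(l(D)\le\beta\le u(D))\ge 1-\alpha$. Then there are constants $c_1,c_2>0$, depending only on $M,M_1,M_2,c,\alpha$, such that for all integers $n\ge1$, $p\ge 1$, $s$ and $s_1$ with $s n^{-1}\log p\le 1/4$, $2\le s\le p^{c}$ and $1\le s_1\le s/2$, $$c_1\left(n^{-1/2}+s n^{-1}\log p\right)\ \le\ \inf_{CI\in\mathcal C_\alpha(\Theta(s))}\ \sup_{\theta\in\Theta(s_1)}\mathbb E_\theta\,\mathrm{diam}(CI)\ \le\ c_2\left(n^{-1/2}+s n^{-1}\log p\right).$$ -/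

import Mathlib

open MeasureTheory ProbabilityTheory
open scoped ENNReal NNReal

noncomputable section

/-- The parameter `θ = (β, γ, Σ, σ)` of the random-design linear model with `p` covariates.
The coefficients are stored as one vector `(β, γ)`; the entry with index `0` is `β`. -/
structure Param (p : ℕ) where
  coef : EuclideanSpace ℝ (Fin p)
  cov : Matrix (Fin p) (Fin p) ℝ
  sigma : ℝ

/-- The parameter of interest: the first regression coefficient. -/
def Param.beta {p : ℕ} [NeZero p] (θ : Param p) : ℝ := θ.coef 0

/-- The number of nonzero entries of the first row of the precision matrix `Ω = Σ⁻¹`. -/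
def Param.rowSparsity {p : ℕ} [NeZero p] (θ : Param p) : ℕ :=
  Set.ncard {j : Fin p | θ.cov⁻¹ 0 j ≠ 0}

/-- The data: `n` observations `(yᵢ, Xᵢ)` with `Xᵢ = (Zᵢ, Wᵢ) ∈ ℝᵖ`. -/
abbrev Data (n p : ℕ) : Type := Fin n → ℝ × EuclideanSpace ℝ (Fin p)

/-- The law of one observation `(y, X)`: `X ~ N(0, Σ)` and `ε ~ N(0, σ²)` are independent and
`y = ⟨X, (β, γ)⟩ + ε = Z β + W γ + ε`. -/
def Param.obsLaw {p : ℕ} (θ : Param p) : Measure (ℝ × EuclideanSpace ℝ (Fin p)) :=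
  ((multivariateGaussian (0 : EuclideanSpace ℝ (Fin p)) θ.cov).prod
    (gaussianReal 0 (θ.sigma ^ 2).toNNReal)).map
      (fun xe => (inner ℝ xe.1 θ.coef + xe.2, xe.1))

/-- The law `P_θ` of `n` i.i.d. observations. -/
def Param.law {p : ℕ} (n : ℕ) (θ : Param p) : Measure (Data n p) :=
  Measure.pi (fun _ : Fin n => θ.obsLaw)

/-- The parameter space `Θ`: `Σ` is symmetric with all eigenvalues in `[M⁻¹, M]`, the covariance
matrix of `W` (the block of `Σ` without the first row and column) is the identity,
`0 ≤ σ ≤ M₁` and `‖(β, γ)‖₂ ≤ M₂`. -/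
def paramSpace (p : ℕ) [NeZero p] (M M₁ M₂ : ℝ) : Set (Param p) :=
  {θ | (∃ h : θ.cov.IsHermitian, ∀ i, M⁻¹ ≤ h.eigenvalues i ∧ h.eigenvalues i ≤ M) ∧
    (∀ i j : Fin p, i ≠ 0 → j ≠ 0 → θ.cov i j = if i = j then 1 else 0) ∧
    0 ≤ θ.sigma ∧ θ.sigma ≤ M₁ ∧ ‖θ.coef‖ ≤ M₂}

/-- The space `Θ(s)`: the parameters in `Θ` for which the first row of the precision matrix has at
most `s` nonzero entries. -/
def sparseSpace (p : ℕ) [NeZero p] (M M₁ M₂ : ℝ) (s : ℕ) : Set (Param p) :=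
  {θ ∈ paramSpace p M M₁ M₂ | θ.rowSparsity ≤ s}

/-- The set `C_α(Θ₁)` of confidence intervals `[l(D), u(D)]` for `β` with coverage at least `1 - α`
at every point of `Θ₁`; an interval is given by its two measurable end points. -/
def validCI {n p : ℕ} [NeZero p] (α : ℝ) (Θ₁ : Set (Param p)) :
    Set ((Data n p → ℝ) × (Data n p → ℝ)) :=
  {I | Measurable I.1 ∧ Measurable I.2 ∧
    ∀ θ ∈ Θ₁, ENNReal.ofReal (1 - α) ≤ θ.law n {D | I.1 D ≤ θ.beta ∧ θ.beta ≤ I.2 D}}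

/-- The minimax expected length, over `Θ₁`, of the confidence intervals that are valid over `Θ₀`:
the infimum over `CI ∈ C_α(Θ₀)` of `sup_{θ ∈ Θ₁} E_θ diam(CI)`. -/
def minimaxLength (n : ℕ) {p : ℕ} [NeZero p] (α : ℝ) (Θ₀ Θ₁ : Set (Param p)) : ℝ≥0∞ :=
  ⨅ I ∈ validCI (n := n) α Θ₀, ⨆ θ ∈ Θ₁,
    ∫⁻ D, Metric.ediam (Set.Icc (I.1 D) (I.2 D)) ∂(θ.law n)

end

/-!
The minimax length over `Θ(s₁)` of intervals valid over `Θ(s)` is of order `1 / √n + s log p / n`.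
Write `b` for the covariances between the first covariate `Z` and the others `W`, and `v` for those
between `y` and `W`. Since `W` has identity covariance, `b` is also the regression of `Z` on `W`,
the first row of the precision matrix is proportional to `(1, -b)`, and
`β (Var Z - ‖b‖²) = Cov(y, Z) - ⟨b, v⟩`.

*Upper bound.* Half of the sample gives pilot estimates `b'`, `v'` of `b` and `v` by hard
thresholding at a level `lam` of order `√(log p / n)`; thresholding `v'` is not meant to exploit
sparsity (`v` may be dense) but to keep `‖v'‖` bounded. The other half estimates
`Cov(y, Z) - ⟨b', v⟩ - ⟨b, v'⟩ + ⟨b', v'⟩`, which is biased by `⟨b - b', v - v'⟩` only. As `b - b'`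
has at most `s` nonzero entries and all entries of `b - b'` and `v - v'` are `O(lam)`, the bias is
`O(s log p / n)`. The same holds for `‖b‖²`, and the interval is the resulting ratio plus or minus a
deterministic radius (`abs_betaEst_sub_le`, `measure_splitEst_deviation_le`, `minimaxLength_le`).
The only probabilistic tool is Bernstein's inequality for averages of products of two linear forms
of the Gaussian observations (`measure_cross_deviation_le`).

*Lower bound.* An interval that covers under the null and under a mixture of alternatives close to
it in total variation is long at the null (`le_minimaxLength`). For the rate `s log p / n` the
alternatives move `b` and `v` simultaneously along the same sparse vector, while `Var y`, `Var Z` and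
`Cov(y, Z) = 0` are kept; then `β` moves by an amount of order `‖b‖² = s log p / n`. If `y` and `Z`
have the same variance, then `y - Z` is independent of everything else, and the problem becomes that
of detecting the regression of the single variable `u = y + Z` on `W`, with `u` and `W` standard
Gaussian under the null (`obsLaw_spikeParam`). For two coefficient vectors `g`, `g'` of such a
regression the likelihood ratios have the explicit affinity `(1 - ⟨g, g'⟩)⁻¹`
(`lintegral_likRatio_mul`). The supports are drawn by choosing one coordinate in each of `s - 1`
blocks, so that the overlap of two supports is a sum of independent indicators and the averaged
affinity factorizes (`sum_affinity_blockVec_le`); it is close to one because `s ≤ p ^ c` with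
`c < 1 / 2`. The rate `1 / √n` comes from a two point comparison with the same affinity formula.
-/


/-! ### Quadratic forms and Gaussian linear forms -/

/-- The symmetric bilinear form `(x, y) ↦ xᵀ S y` of a matrix, on Euclidean space. -/
noncomputable def covForm {p : ℕ} (S : Matrix (Fin p) (Fin p) ℝ) (x y : EuclideanSpace ℝ (Fin p)) :
    ℝ :=
  inner ℝ x (Matrix.toEuclideanCLM (𝕜 := ℝ) S y)

section covForm

variable {p : ℕ} (S : Matrix (Fin p) (Fin p) ℝ) (x x' y y' : EuclideanSpace ℝ (Fin p)) (c : ℝ)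

lemma covForm_eq_dotProduct : covForm S x y = x.ofLp ⬝ᵥ S.mulVec y.ofLp := by
  rw [covForm, EuclideanSpace.inner_eq_star_dotProduct, Matrix.ofLp_toEuclideanCLM,
    dotProduct_comm]
  simp

lemma covForm_add_left : covForm S (x + x') y = covForm S x y + covForm S x' y := inner_add_left ..

lemma covForm_sub_left : covForm S (x - x') y = covForm S x y - covForm S x' y := inner_sub_left ..

lemma covForm_smul_left : covForm S (c • x) y = c * covForm S x y := real_inner_smul_left ..

lemma covForm_add_right : covForm S x (y + y') = covForm S x y + covForm S x y' := by
  simp [covForm, inner_add_right]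

lemma covForm_sub_right : covForm S x (y - y') = covForm S x y - covForm S x y' := by
  simp [covForm, inner_sub_right]

lemma covForm_smul_right : covForm S x (c • y) = c * covForm S x y := by
  simp [covForm, real_inner_smul_right]

variable {S}

lemma covForm_comm (hS : S.IsHermitian) : covForm S x y = covForm S y x := by
  have h : S.transpose = S := hS
  rw [covForm_eq_dotProduct, covForm_eq_dotProduct, Matrix.dotProduct_mulVec,
    ← Matrix.mulVec_transpose, h, dotProduct_comm]

lemma covForm_single_single (i j : Fin p) :
    covForm S (EuclideanSpace.single i 1) (EuclideanSpace.single j 1) = S i j := by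
  simp [covForm_eq_dotProduct]

lemma covForm_eq_sum_eigenvalues (hS : S.IsHermitian) :
    covForm S x x = ∑ i, hS.eigenvalues i * inner ℝ (hS.eigenvectorBasis i) x ^ 2 := by
  have key (i) : inner ℝ (hS.eigenvectorBasis i) (Matrix.toEuclideanCLM (𝕜 := ℝ) S x)
      = hS.eigenvalues i * inner ℝ (hS.eigenvectorBasis i) x := by
    change covForm S _ _ = _
    rw [covForm_comm _ _ hS, covForm_eq_dotProduct, hS.mulVec_eigenvectorBasis, dotProduct_smul,
      EuclideanSpace.inner_eq_star_dotProduct]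
    simp
  rw [covForm, ← (hS.eigenvectorBasis).sum_inner_mul_inner x]
  refine Finset.sum_congr rfl fun i _ => ?_
  rw [key, real_inner_comm]
  ring

/-- Bounds on the eigenvalues bound the quadratic form. -/
lemma covForm_self_bounds (hS : S.IsHermitian) {a b : ℝ}
    (h : ∀ i, a ≤ hS.eigenvalues i ∧ hS.eigenvalues i ≤ b) :
    a * ‖x‖ ^ 2 ≤ covForm S x x ∧ covForm S x x ≤ b * ‖x‖ ^ 2 := by
  have hx : ‖x‖ ^ 2 = ∑ i, inner ℝ (hS.eigenvectorBasis i) x ^ 2 := by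
    rw [← (hS.eigenvectorBasis).sum_sq_norm_inner_right x]
    simp
  rw [covForm_eq_sum_eigenvalues x hS, hx, Finset.mul_sum, Finset.mul_sum]
  exact ⟨Finset.sum_le_sum fun i _ => mul_le_mul_of_nonneg_right (h i).1 (sq_nonneg _),
    Finset.sum_le_sum fun i _ => mul_le_mul_of_nonneg_right (h i).2 (sq_nonneg _)⟩

lemma eigenvalues_bounds (hS : S.IsHermitian) {a b : ℝ}
    (h : ∀ x, a * ‖x‖ ^ 2 ≤ covForm S x x ∧ covForm S x x ≤ b * ‖x‖ ^ 2) (i : Fin p) :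
    a ≤ hS.eigenvalues i ∧ hS.eigenvalues i ≤ b := by
  have h1 : covForm S (hS.eigenvectorBasis i) (hS.eigenvectorBasis i) = hS.eigenvalues i := by
    rw [hS.eigenvalues_eq, covForm_eq_dotProduct]
    simp
  have h2 := h (hS.eigenvectorBasis i)
  rw [h1] at h2
  simpa using h2

lemma posSemidef_of_eigenvalues (hS : S.IsHermitian) {a : ℝ} (ha : 0 ≤ a)
    (h : ∀ i, a ≤ hS.eigenvalues i) : S.PosSemidef :=
  hS.posSemidef_iff_eigenvalues_nonneg.2 fun i => ha.trans (h i)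

lemma covForm_one : covForm (1 : Matrix (Fin p) (Fin p) ℝ) x y = inner ℝ x y := by
  simp [covForm]

end covForm

section GaussianForms

variable {p : ℕ}

/-- The linear form `(y, x) ↦ c y + ⟨z, x⟩` of an observation. -/
noncomputable def linForm (c : ℝ) (z : EuclideanSpace ℝ (Fin p)) :
    (ℝ × EuclideanSpace ℝ (Fin p)) →L[ℝ] ℝ :=
  c • ContinuousLinearMap.fst ℝ ℝ _ + (innerSL ℝ z).comp (ContinuousLinearMap.snd ℝ ℝ _)

@[simp] lemma linForm_apply (c : ℝ) (z : EuclideanSpace ℝ (Fin p))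
    (d : ℝ × EuclideanSpace ℝ (Fin p)) : linForm c z d = c * d.1 + inner ℝ z d.2 := by
  simp [linForm]

lemma exists_eq_linForm (L : StrongDual ℝ (ℝ × EuclideanSpace ℝ (Fin p))) :
    ∃ c z, L = linForm c z := by
  refine ⟨L (1, 0), (InnerProductSpace.toDual ℝ _).symm (L.comp (.inr ℝ ℝ _)), ?_⟩
  ext x
  · simp
  · simp

/-- The covariance of the linear forms with coefficients `(c, z)` and `(c', z')`. -/
noncomputable def Param.cross (θ : Param p) (c : ℝ) (z : EuclideanSpace ℝ (Fin p)) (c' : ℝ)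
    (z' : EuclideanSpace ℝ (Fin p)) : ℝ :=
  c * c' * θ.sigma ^ 2 + covForm θ.cov (z + c • θ.coef) (z' + c' • θ.coef)

/-- The map which turns covariates and noise into an observation. -/
noncomputable def Param.obsMap (θ : Param p) :
    (EuclideanSpace ℝ (Fin p) × ℝ) →L[ℝ] (ℝ × EuclideanSpace ℝ (Fin p)) :=
  ((innerSL ℝ θ.coef).comp (ContinuousLinearMap.fst ℝ _ ℝ) + ContinuousLinearMap.snd ℝ _ ℝ).prod
    (ContinuousLinearMap.fst ℝ _ ℝ)

lemma Param.obsLaw_eq_map (θ : Param p) :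
    θ.obsLaw = ((multivariateGaussian 0 θ.cov).prod
      (gaussianReal 0 (θ.sigma ^ 2).toNNReal)).map θ.obsMap := by
  rw [Param.obsLaw]
  congr 1
  ext xe <;> simp [Param.obsMap, real_inner_comm]

instance (θ : Param p) : IsProbabilityMeasure θ.obsLaw := by
  rw [θ.obsLaw_eq_map]
  exact Measure.isProbabilityMeasure_map (by fun_prop)

instance (n : ℕ) (θ : Param p) : IsProbabilityMeasure (θ.law n) := by
  unfold Param.law; infer_instance

/-- The characteristic function of a centred Gaussian vector with independent Gaussian noise. -/
lemma charFunDual_gaussian_prod {S : Matrix (Fin p) (Fin p) ℝ} (hS : S.PosSemidef) (v : ℝ≥0)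
    (L : StrongDual ℝ (EuclideanSpace ℝ (Fin p) × ℝ)) (w : EuclideanSpace ℝ (Fin p)) (d : ℝ)
    (hL : ∀ x e, L (x, e) = inner ℝ w x + d * e) :
    charFunDual ((multivariateGaussian 0 S).prod (gaussianReal 0 v)) L =
      Complex.exp (-((covForm S w w + v * d ^ 2 : ℝ) : ℂ) / 2) := by
  have h1 : charFunDual (multivariateGaussian 0 S) (L.comp (.inl ℝ _ ℝ)) =
      charFun (multivariateGaussian 0 S) w := by
    rw [charFunDual_apply, charFun_apply]
    simp [hL, real_inner_comm]
  have h2 : charFunDual (gaussianReal 0 v) (L.comp (.inr ℝ (EuclideanSpace ℝ (Fin p)) ℝ)) =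
      charFun (gaussianReal 0 v) d := by
    rw [charFunDual_apply, charFun_apply]
    simp [hL, mul_comm]
  rw [charFunDual_prod, h1, h2, charFun_multivariateGaussian hS, charFun_gaussianReal,
    ← Complex.exp_add, covForm_eq_dotProduct]
  congr 1
  simp
  ring

lemma charFunDual_obsLaw {θ : Param p} (hS : θ.cov.PosSemidef) (c : ℝ)
    (z : EuclideanSpace ℝ (Fin p)) :
    charFunDual θ.obsLaw (linForm c z) = Complex.exp (-((θ.cross c z c z : ℝ) : ℂ) / 2) := by
  rw [θ.obsLaw_eq_map, charFunDual_map,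
    charFunDual_gaussian_prod hS _ _ (z + c • θ.coef) c]
  · rw [Param.cross, Real.coe_toNNReal _ (sq_nonneg _)]
    congr 4
    ring
  · intro x e
    simp [Param.obsMap, inner_add_left, real_inner_smul_left]
    ring

/-- A linear form of an observation is a centred Gaussian variable. -/
lemma map_linForm_obsLaw {θ : Param p} (hS : θ.cov.PosSemidef) (c : ℝ)
    (z : EuclideanSpace ℝ (Fin p)) (hv : 0 ≤ θ.cross c z c z) :
    θ.obsLaw.map (linForm c z) = gaussianReal 0 (θ.cross c z c z).toNNReal := by
  have : IsProbabilityMeasure (θ.obsLaw.map (linForm c z)) :=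
    Measure.isProbabilityMeasure_map (by fun_prop)
  refine Measure.ext_of_charFun (funext fun t => ?_)
  have h : t • linForm c z = linForm (t * c) (t • z) := by
    ext x <;> simp [real_inner_smul_left]
  rw [charFun_map_eq_charFunDual_smul, h, charFunDual_obsLaw hS, charFun_gaussianReal,
    Real.coe_toNNReal _ hv]
  have h2 : θ.cross (t * c) (t • z) (t * c) (t • z) = t ^ 2 * θ.cross c z c z := by
    simp only [Param.cross, mul_smul, ← smul_add, covForm_smul_left, covForm_smul_right]
    ring
  rw [h2]
  congr 1
  push_cast
  ring

end GaussianForms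

/-! ### Gaussian integrals and concentration of products of Gaussian variables -/

/-- The exponential of a quadratic polynomial, integrated against the standard Gaussian measure. -/
lemma lintegral_exp_quadratic_gaussianReal {a : ℝ} (ha : -1 < a) (b : ℝ) :
    ∫⁻ x, ENNReal.ofReal (Real.exp (-(a / 2) * x ^ 2 + b * x)) ∂(gaussianReal 0 1) =
      ENNReal.ofReal ((√(1 + a))⁻¹ * Real.exp (b ^ 2 / (2 * (1 + a)))) := by
  have ha' : 0 < 1 + a := by linarith
  have key (x : ℝ) : gaussianPDFReal 0 1 x * Real.exp (-(a / 2) * x ^ 2 + b * x) =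
      ((√(2 * Real.pi))⁻¹ * Real.exp (b ^ 2 / (2 * (1 + a)))) *
        Real.exp (-((1 + a) / 2) * (x - b / (1 + a)) ^ 2) := by
    simp only [gaussianPDFReal, NNReal.coe_one, mul_one, sub_zero, mul_assoc, ← Real.exp_add]
    congr 2
    field_simp
    ring
  have hint : Integrable (fun x : ℝ => Real.exp (-((1 + a) / 2) * (x - b / (1 + a)) ^ 2)) :=
    (integrable_exp_neg_mul_sq (b := (1 + a) / 2) (by positivity)).comp_sub_right _
  rw [gaussianReal_of_var_ne_zero 0 one_ne_zero,
    lintegral_withDensity_eq_lintegral_mul _ (measurable_gaussianPDF 0 1) (by fun_prop)]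
  simp only [Pi.mul_apply, gaussianPDF, ← ENNReal.ofReal_mul (gaussianPDFReal_nonneg 0 1 _), key]
  rw [← ofReal_integral_eq_lintegral_ofReal (hint.const_mul _)
    (Filter.Eventually.of_forall fun x => by positivity), integral_const_mul,
    integral_sub_right_eq_self (fun x : ℝ => Real.exp (-((1 + a) / 2) * x ^ 2)),
    integral_gaussian]
  congr 1
  rw [show Real.pi / ((1 + a) / 2) = (2 * Real.pi) / (1 + a) by field_simp,
    Real.sqrt_div (by positivity)]
  field_simp

/-- The square of a centred Gaussian variable of variance at most `V` has an exponential moment. -/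
lemma integrable_exp_sq_gaussian {Ω : Type*} [MeasurableSpace Ω] {μ : Measure Ω} {X : Ω → ℝ}
    (hX : Measurable X) {v : ℝ≥0} (hl : μ.map X = gaussianReal 0 v) {V : ℝ} (hV : 0 < V)
    (hv : (v : ℝ) ≤ V) :
    Integrable (fun ω => Real.exp (X ω ^ 2 / (4 * V))) μ ∧
      ∫ ω, Real.exp (X ω ^ 2 / (4 * V)) ∂μ ≤ √2 := by
  have hlin : ∫⁻ ω, ENNReal.ofReal (Real.exp (X ω ^ 2 / (4 * V))) ∂μ =
      ENNReal.ofReal ((√(1 + -(v / (2 * V))))⁻¹) := by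
    have h1 : gaussianReal 0 v = (gaussianReal 0 1).map (fun x => √v * x) := by
      rw [gaussianReal_map_const_mul]
      congr 1
      · simp
      · ext; simp
    rw [← lintegral_map (f := fun x => ENNReal.ofReal (Real.exp (x ^ 2 / (4 * V))))
      (by fun_prop) hX, hl, h1, lintegral_map (by fun_prop) (by fun_prop)]
    have h2 : (v : ℝ) / (2 * V) ≤ 1 / 2 := by
      rw [div_le_div_iff₀ (by positivity) (by norm_num)]; linarith
    have h3 := lintegral_exp_quadratic_gaussianReal (a := -(v / (2 * V))) (by linarith) 0
    simp only [zero_mul, add_zero, ne_eq, OfNat.ofNat_ne_zero, not_false_eq_true, zero_pow,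
      zero_div, Real.exp_zero, mul_one] at h3
    rw [← h3]
    refine lintegral_congr fun x => ?_
    rw [mul_pow, show (√(v : ℝ)) ^ 2 = (v : ℝ) from Real.sq_sqrt v.2]
    congr 2
    field_simp
    ring
  have hint : Integrable (fun ω => Real.exp (X ω ^ 2 / (4 * V))) μ := by
    refine ⟨by fun_prop, ?_⟩
    rw [hasFiniteIntegral_iff_ofReal (Filter.Eventually.of_forall fun x => by positivity), hlin]
    exact ENNReal.ofReal_lt_top
  refine ⟨hint, ?_⟩
  rw [integral_eq_lintegral_of_nonneg_ae (Filter.Eventually.of_forall fun x => by positivity)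
    (by fun_prop), hlin, ENNReal.toReal_ofReal (by positivity)]
  have h2 : (v : ℝ) / (2 * V) ≤ 1 / 2 := by
    rw [div_le_div_iff₀ (by positivity) (by norm_num)]; linarith
  rw [← Real.sqrt_inv]
  apply Real.sqrt_le_sqrt
  rw [inv_le_comm₀ (by linarith) (by norm_num)]
  linarith

lemma integral_sq_gaussian {Ω : Type*} [MeasurableSpace Ω] {μ : Measure Ω} {X : Ω → ℝ}
    (hX : Measurable X) {v : ℝ≥0} (hl : μ.map X = gaussianReal 0 v) :
    Integrable (fun ω => X ω ^ 2) μ ∧ ∫ ω, X ω ^ 2 ∂μ = v := by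
  have hm : MemLp id 2 (gaussianReal 0 v) := memLp_id_gaussianReal 2
  constructor
  · have : Integrable (fun x : ℝ => x ^ 2) (μ.map X) := by
      rw [hl]; exact hm.integrable_sq
    exact this.comp_measurable hX
  · rw [← integral_map (f := fun x : ℝ => x ^ 2) hX.aemeasurable (by fun_prop), hl]
    have := variance_fun_id_gaussianReal (μ := 0) (v := v)
    rw [variance_eq_integral (by fun_prop)] at this
    simpa using this

lemma exp_le_quadratic_exp_abs (x : ℝ) : Real.exp x ≤ 1 + x + x ^ 2 * Real.exp |x| := by
  have h := Complex.norm_exp_sub_sum_le_norm_mul_exp (x : ℂ) 2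
  have e : Complex.exp x - ∑ m ∈ Finset.range 2, (x : ℂ) ^ m / m.factorial =
      ((Real.exp x - (1 + x) : ℝ) : ℂ) := by
    simp [Finset.sum_range_succ]
  rw [e, Complex.norm_real, Complex.norm_real, Real.norm_eq_abs, Real.norm_eq_abs, sq_abs] at h
  linarith [(abs_le.1 h).2]

/-- A centred product of two Gaussian variables is sub-exponential. -/
lemma mgf_gaussian_mul_le {Ω : Type*} [MeasurableSpace Ω] {μ : Measure Ω} [IsProbabilityMeasure μ]
    {X Y : Ω → ℝ} (hX : Measurable X) (hY : Measurable Y) {v w : ℝ≥0}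
    (hlX : μ.map X = gaussianReal 0 v) (hlY : μ.map Y = gaussianReal 0 w) {V : ℝ} (hV : 0 < V)
    (hv : (v : ℝ) ≤ V) (hw : (w : ℝ) ≤ V) {m : ℝ} (hm : ∫ ω, X ω * Y ω ∂μ = m) {t : ℝ}
    (ht : |t| ≤ 1 / (8 * V)) :
    Integrable (fun ω => Real.exp (t * (X ω * Y ω - m))) μ ∧
      mgf (fun ω => X ω * Y ω - m) μ t ≤ Real.exp (256 * V ^ 2 * t ^ 2) := by
  obtain ⟨iX, eX⟩ := integrable_exp_sq_gaussian hX hlX hV hv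
  obtain ⟨iY, eY⟩ := integrable_exp_sq_gaussian hY hlY hV hw
  obtain ⟨jX, sX⟩ := integral_sq_gaussian hX hlX
  obtain ⟨jY, sY⟩ := integral_sq_gaussian hY hlY
  have habs (ω) : |X ω * Y ω| ≤ (X ω ^ 2 + Y ω ^ 2) / 2 := by
    rw [abs_mul, ← sq_abs (X ω), ← sq_abs (Y ω)]
    nlinarith [sq_nonneg (|X ω| - |Y ω|)]
  have jXY : Integrable (fun ω => X ω * Y ω) μ :=
    ((jX.add jY).div_const 2).mono' (by fun_prop) (Filter.Eventually.of_forall habs)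
  have hmV : |m| ≤ V := by
    rw [← hm]
    calc |∫ ω, X ω * Y ω ∂μ| ≤ ∫ ω, |X ω * Y ω| ∂μ := abs_integral_le_integral_abs
      _ ≤ ∫ ω, (X ω ^ 2 + Y ω ^ 2) / 2 ∂μ :=
        integral_mono jXY.abs ((jX.add jY).div_const 2) habs
      _ = (v + w) / 2 := by rw [integral_div, integral_add jX jY, sX, sY]
      _ ≤ V := by linarith
  have hD (ω) : 2 * (1 / (8 * V)) * |X ω * Y ω - m| ≤
      (X ω ^ 2 / (4 * V) + Y ω ^ 2 / (4 * V)) / 2 + 1 / 4 := by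
    have h1 : |X ω * Y ω - m| ≤ (X ω ^ 2 + Y ω ^ 2) / 2 + V :=
      (abs_sub _ _).trans (add_le_add (habs ω) hmV)
    calc 2 * (1 / (8 * V)) * |X ω * Y ω - m|
        ≤ 2 * (1 / (8 * V)) * ((X ω ^ 2 + Y ω ^ 2) / 2 + V) := by gcongr
      _ = _ := by field_simp; ring
  have hconv (x y : ℝ) : Real.exp ((x + y) / 2) ≤ (Real.exp x + Real.exp y) / 2 := by
    have e1 : Real.exp ((x + y) / 2) = Real.exp (x / 2) * Real.exp (y / 2) := by
      rw [← Real.exp_add]; ring_nf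
    have e2 (z : ℝ) : Real.exp z = Real.exp (z / 2) ^ 2 := by
      rw [← Real.exp_nat_mul]; ring_nf
    rw [e1, e2 x, e2 y]
    nlinarith [sq_nonneg (Real.exp (x / 2) - Real.exp (y / 2))]
  set G : Ω → ℝ := fun ω =>
    (Real.exp (X ω ^ 2 / (4 * V)) + Real.exp (Y ω ^ 2 / (4 * V))) / 2 * Real.exp (1 / 4) with hG
  have iG : Integrable G μ := ((iX.add iY).div_const 2).mul_const _
  have hexp (ω) : Real.exp (2 * (1 / (8 * V)) * |X ω * Y ω - m|) ≤ G ω := by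
    refine (Real.exp_le_exp.2 (hD ω)).trans ?_
    rw [Real.exp_add]
    exact mul_le_mul_of_nonneg_right (hconv _ _) (Real.exp_pos _).le
  have hpt (ω) : Real.exp (t * (X ω * Y ω - m)) ≤
      1 + t * (X ω * Y ω - m) + 128 * V ^ 2 * t ^ 2 * G ω := by
    set D := X ω * Y ω - m
    have h1 := exp_le_quadratic_exp_abs (t * D)
    have h2 : |t * D| ≤ 1 / (8 * V) * |D| := by rw [abs_mul]; gcongr
    have h3 : (1 / (8 * V) * |D|) ^ 2 ≤ 2 * Real.exp (1 / (8 * V) * |D|) := by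
      have := Real.quadratic_le_exp_of_nonneg (x := 1 / (8 * V) * |D|) (by positivity)
      have h4 : 0 ≤ 1 / (8 * V) * |D| := by positivity
      linarith
    have h5 : (t * D) ^ 2 * Real.exp |t * D| ≤ 128 * V ^ 2 * t ^ 2 * G ω := by
      calc (t * D) ^ 2 * Real.exp |t * D|
          = 64 * V ^ 2 * t ^ 2 * ((1 / (8 * V) * |D|) ^ 2 * Real.exp |t * D|) := by
            rw [mul_pow, mul_pow, sq_abs]; field_simp; ring
        _ ≤ 64 * V ^ 2 * t ^ 2 * (2 * Real.exp (1 / (8 * V) * |D|) *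
              Real.exp (1 / (8 * V) * |D|)) := by gcongr
        _ = 128 * V ^ 2 * t ^ 2 * Real.exp (2 * (1 / (8 * V)) * |D|) := by
            rw [mul_assoc 2, ← Real.exp_add]; ring_nf
        _ ≤ _ := by gcongr; exact hexp ω
    linarith
  have iD : Integrable (fun ω => X ω * Y ω - m) μ := jXY.sub (integrable_const _)
  have iR : Integrable (fun ω => 1 + t * (X ω * Y ω - m) + 128 * V ^ 2 * t ^ 2 * G ω) μ :=
    ((integrable_const _).add (iD.const_mul _)).add (iG.const_mul _)
  have iE : Integrable (fun ω => Real.exp (t * (X ω * Y ω - m))) μ := by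
    refine iR.mono' (by fun_prop) (Filter.Eventually.of_forall fun ω => ?_)
    rw [Real.norm_eq_abs, abs_of_pos (Real.exp_pos _)]
    exact hpt ω
  refine ⟨iE, ?_⟩
  have hGi : ∫ ω, G ω ∂μ ≤ 2 := by
    rw [hG, integral_mul_const, integral_div, integral_add iX iY]
    have e1 : Real.exp (1 / 4) ≤ 4 / 3 := by
      have := Real.exp_bound_div_one_sub_of_interval (x := 1 / 4) (by norm_num) (by norm_num)
      norm_num at this ⊢
      exact this
    have e2 : √2 ≤ 3 / 2 := by
      rw [Real.sqrt_le_left (by norm_num)]; norm_num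
    calc _ ≤ (√2 + √2) / 2 * (4 / 3 : ℝ) := by gcongr
      _ ≤ 2 := by linarith
  calc mgf (fun ω => X ω * Y ω - m) μ t
      ≤ ∫ ω, (1 + t * (X ω * Y ω - m) + 128 * V ^ 2 * t ^ 2 * G ω) ∂μ := integral_mono iE iR hpt
    _ = 1 + 128 * V ^ 2 * t ^ 2 * ∫ ω, G ω ∂μ := by
      have i1 : Integrable (fun ω => 1 + t * (X ω * Y ω - m)) μ :=
        (integrable_const _).add (iD.const_mul _)
      rw [integral_add i1 (iG.const_mul _),
        integral_add (integrable_const _) (iD.const_mul _), integral_const_mul,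
        integral_const_mul, integral_sub jXY (integrable_const _), hm]
      simp
    _ ≤ 256 * V ^ 2 * t ^ 2 + 1 := by nlinarith [sq_nonneg (V * t)]
    _ ≤ _ := Real.add_one_le_exp _

/-- Bernstein's inequality for an average of centred products of Gaussian variables. Up to the
scale `q ≤ 1` the tail is Gaussian. -/
lemma measure_abs_mean_ge_le {Ω ι : Type*} [MeasurableSpace Ω] [Fintype ι] [Nonempty ι]
    {μ : Measure Ω} [IsProbabilityMeasure μ]
    {f : Ω → ℝ} (hf : Measurable f) {V : ℝ} (hV : 0 < V)
    (h : ∀ t, |t| ≤ 1 / (8 * V) → Integrable (fun ω => Real.exp (t * f ω)) μ ∧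
      mgf f μ t ≤ Real.exp (256 * V ^ 2 * t ^ 2)) {q A : ℝ} (hq : 0 ≤ q) (hq1 : q ≤ 1) :
    (Measure.pi fun _ : ι => μ).real
        {x | 8 * V * (4 + A) * q ≤ |(∑ i, f (x i)) / Fintype.card ι|} ≤
      2 * Real.exp (-(A * Fintype.card ι * q ^ 2)) := by
  set P := Measure.pi fun _ : ι => μ
  have hcard : (0 : ℝ) < Fintype.card ι := by exact_mod_cast Fintype.card_pos
  have one (σ : ℝ) (hσ : |σ| = 1) :
      P.real {x | 8 * V * (4 + A) * q * Fintype.card ι ≤ σ * ∑ i, f (x i)} ≤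
        Real.exp (-(A * Fintype.card ι * q ^ 2)) := by
    set t : ℝ := 1 / (8 * V) * q
    have ht0 : 0 ≤ t := by positivity
    have htb : |t * σ| ≤ 1 / (8 * V) := by
      rw [abs_mul, hσ, mul_one, abs_of_nonneg ht0]
      exact mul_le_of_le_one_right (by positivity) hq1
    obtain ⟨hi, hm⟩ := h _ htb
    have hind : iIndepFun (fun (i : ι) (x : ι → Ω) => σ * f (x i)) P :=
      iIndepFun_pi (X := fun _ ω => σ * f ω) fun i => by fun_prop
    have hlaw (i : ι) : MeasurePreserving (fun x : ι → Ω => x i) P μ := measurePreserving_eval _ i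
    have hmgf (i : ι) : mgf (fun x : ι → Ω => σ * f (x i)) P t = mgf f μ (t * σ) := by
      rw [mgf, mgf, ← (hlaw i).map_eq,
        integral_map (hlaw i).measurable.aemeasurable (by fun_prop)]
      simp [mul_assoc]
    have hint (i : ι) : Integrable (fun x : ι → Ω => Real.exp (t * (σ * f (x i)))) P := by
      have := (hlaw i).integrable_comp_of_integrable hi
      simpa [Function.comp_def, mul_assoc] using this
    have hsum : (fun x : ι → Ω => σ * ∑ i, f (x i)) = ∑ i, fun x : ι → Ω => σ * f (x i) := by
      ext x; simp [Finset.mul_sum]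
    have hI : Integrable (fun x : ι → Ω => Real.exp (t * (σ * ∑ i, f (x i)))) P := by
      have := hind.integrable_exp_mul_sum (t := t) (fun i => by fun_prop) (s := Finset.univ)
        fun i _ => hint i
      rw [← hsum] at this
      exact this
    refine (measure_ge_le_exp_mul_mgf _ ht0 hI).trans ?_
    rw [hsum, hind.mgf_sum (fun i => by fun_prop)]
    simp only [hmgf, Finset.prod_const, Finset.card_univ]
    calc _ ≤ Real.exp (-t * (8 * V * (4 + A) * q * Fintype.card ι)) *
          Real.exp (256 * V ^ 2 * (t * σ) ^ 2) ^ Fintype.card ι := by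
          gcongr
          exact mgf_nonneg
      _ = _ := by
        rw [← Real.exp_nat_mul, ← Real.exp_add, mul_pow, ← sq_abs σ, hσ]
        congr 1
        simp only [t]
        field_simp
        ring
  have hsub : {x : ι → Ω | 8 * V * (4 + A) * q ≤ |(∑ i, f (x i)) / Fintype.card ι|} ⊆
      {x | 8 * V * (4 + A) * q * Fintype.card ι ≤ 1 * ∑ i, f (x i)} ∪
      {x | 8 * V * (4 + A) * q * Fintype.card ι ≤ -1 * ∑ i, f (x i)} := by
    intro x hx
    simp only [Set.mem_ofPred_eq, abs_div, Nat.abs_cast, Set.mem_union] at hx ⊢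
    rw [le_div_iff₀ hcard] at hx
    rcases le_abs.1 hx with h | h
    · left; linarith
    · right; linarith
  calc _ ≤ _ := measureReal_mono hsub
    _ ≤ _ := measureReal_union_le _ _
    _ ≤ _ := by
      have h1 := one 1 (by simp)
      have h2 := one (-1) (by simp)
      linarith

section Cross

variable {p : ℕ} {θ : Param p}

lemma Param.cross_self_nonneg (hS : θ.cov.PosSemidef) (c : ℝ) (z : EuclideanSpace ℝ (Fin p)) :
    0 ≤ θ.cross c z c z := by
  have : 0 ≤ covForm θ.cov (z + c • θ.coef) (z + c • θ.coef) := by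
    rw [covForm_eq_dotProduct]
    exact hS.dotProduct_mulVec_nonneg (z + c • θ.coef).ofLp
  rw [Param.cross]
  nlinarith [sq_nonneg (c * θ.sigma)]

/-- The expected product of two linear forms, obtained from their variances by polarization. -/
lemma integral_linForm_mul (hS : θ.cov.PosSemidef) (c c' : ℝ)
    (z z' : EuclideanSpace ℝ (Fin p)) :
    ∫ d, linForm c z d * linForm c' z' d ∂θ.obsLaw = θ.cross c z c' z' := by
  have hnn (c z) : 0 ≤ θ.cross c z c z := Param.cross_self_nonneg hS c z
  have hsq (c z) := integral_sq_gaussian (by fun_prop) (map_linForm_obsLaw hS c z (hnn c z))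
  have hpol (d : ℝ × EuclideanSpace ℝ (Fin p)) : linForm c z d * linForm c' z' d =
      (linForm (c + c') (z + z') d ^ 2 - linForm (c - c') (z - z') d ^ 2) / 4 := by
    simp [inner_add_left, inner_sub_left]
    ring
  simp_rw [hpol]
  rw [integral_div, integral_sub (hsq _ _).1 (hsq _ _).1, (hsq _ _).2, (hsq _ _).2,
    Real.coe_toNNReal _ (hnn _ _), Real.coe_toNNReal _ (hnn _ _)]
  have e1 : z + z' + (c + c') • θ.coef = (z + c • θ.coef) + (z' + c' • θ.coef) := by
    rw [add_smul]; abel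
  have e2 : z - z' + (c - c') • θ.coef = (z + c • θ.coef) - (z' + c' • θ.coef) := by
    rw [sub_smul]; abel
  simp only [Param.cross, e1, e2]
  generalize z + c • θ.coef = a, z' + c' • θ.coef = b
  simp only [covForm_add_left, covForm_add_right, covForm_sub_left, covForm_sub_right,
    covForm_comm b a hS.1]
  ring

/-- Concentration of the empirical covariance of two linear forms of the observations. -/
lemma measure_cross_deviation_le {ι : Type*} [Fintype ι] [Nonempty ι] (hS : θ.cov.PosSemidef)
    {c c' : ℝ} {z z' : EuclideanSpace ℝ (Fin p)} {V : ℝ} (hV : 0 < V)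
    (h : θ.cross c z c z ≤ V) (h' : θ.cross c' z' c' z' ≤ V) {q A : ℝ} (hq : 0 ≤ q)
    (hq1 : q ≤ 1) :
    (Measure.pi fun _ : ι => θ.obsLaw).real
        {x | 8 * V * (4 + A) * q ≤
          |(∑ i, linForm c z (x i) * linForm c' z' (x i)) / Fintype.card ι -
            θ.cross c z c' z'|} ≤
      2 * Real.exp (-(A * Fintype.card ι * q ^ 2)) := by
  have hnn (c z) : 0 ≤ θ.cross c z c z := Param.cross_self_nonneg hS c z
  have hcard : (Fintype.card ι : ℝ) ≠ 0 := by exact_mod_cast Fintype.card_ne_zero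
  refine le_of_eq_of_le ?_ (measure_abs_mean_ge_le (ι := ι) (μ := θ.obsLaw)
    (f := fun d => linForm c z d * linForm c' z' d - θ.cross c z c' z') (A := A) (by fun_prop) hV
    (fun t ht => mgf_gaussian_mul_le (by fun_prop) (by fun_prop)
      (map_linForm_obsLaw hS c z (hnn c z)) (map_linForm_obsLaw hS c' z' (hnn c' z')) hV
      (by rwa [Real.coe_toNNReal _ (hnn _ _)]) (by rwa [Real.coe_toNNReal _ (hnn _ _)])
      (integral_linForm_mul hS c c' z z') ht) hq hq1)
  congr 1
  ext x
  simp only [Set.mem_ofPred_eq, Finset.sum_sub_distrib, Finset.sum_const, Finset.card_univ,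
    nsmul_eq_mul, sub_div, mul_div_cancel_left₀ _ hcard]

end Cross

/-! ### Covariance matrices with an identity block -/

lemma isUnit_det_of_covForm {p : ℕ} {S : Matrix (Fin p) (Fin p) ℝ} {a : ℝ} (ha : 0 < a)
    (h : ∀ x, a * ‖x‖ ^ 2 ≤ covForm S x x) : IsUnit S.det := by
  rw [isUnit_iff_ne_zero]
  intro h0
  obtain ⟨v, hv, hv0⟩ := Matrix.exists_mulVec_eq_zero_iff.2 h0
  have h1 := h (WithLp.toLp 2 v)
  rw [covForm_eq_dotProduct] at h1
  simp only [hv0, dotProduct_zero] at h1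
  have h2 : 0 < ‖WithLp.toLp 2 v‖ := by simpa using hv
  nlinarith [mul_pos ha (pow_pos h2 2)]

lemma norm_le_two_mul_of_coord {p : ℕ} {x u : EuclideanSpace ℝ (Fin p)} (h : ∀ j, |x j| ≤ 2 * |u j|) :
    ‖x‖ ≤ 2 * ‖u‖ := by
  refine le_of_sq_le_sq ?_ (by positivity)
  rw [mul_pow, EuclideanSpace.real_norm_sq_eq, EuclideanSpace.real_norm_sq_eq, Finset.mul_sum]
  refine Finset.sum_le_sum fun j _ => ?_
  rw [← sq_abs (x j), ← sq_abs (u j), ← mul_pow]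
  exact pow_le_pow_left₀ (abs_nonneg _) (h j) 2

section Block

variable {p : ℕ} [NeZero p]

/-- The quadratic form of a covariance matrix whose lower right block is the identity, in terms of
the vector `b` of covariances between the first covariate and the others. -/
lemma covForm_block {S : Matrix (Fin p) (Fin p) ℝ} {b : EuclideanSpace ℝ (Fin p)} (hb0 : b 0 = 0)
    (hb : ∀ j, j ≠ 0 → S 0 j = b j ∧ S j 0 = b j)
    (hS : ∀ i j : Fin p, i ≠ 0 → j ≠ 0 → S i j = if i = j then 1 else 0)
    (x y : EuclideanSpace ℝ (Fin p)) :
    covForm S x y = (S 0 0 - 1) * x 0 * y 0 + x 0 * inner ℝ b y + y 0 * inner ℝ b x +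
      inner ℝ x y := by
  have hij (i j : Fin p) : S i j = (S 0 0 - 1) * (if i = 0 then 1 else 0) * (if j = 0 then 1 else 0)
      + (if i = 0 then 1 else 0) * b j + (if j = 0 then 1 else 0) * b i
      + (if i = j then 1 else 0) := by
    by_cases hi : i = 0 <;> by_cases hj : j = 0
    · simp [hi, hj, hb0]
    · simp [hi, hj, hb0, (hb j hj).1, Ne.symm hj]
    · simp [hi, hj, hb0, (hb i hi).2]
    · simp [hi, hj, hS i j hi hj]
  have h1 : covForm S x y = ∑ i, ∑ j, x i * (S i j * y j) := by
    simp [covForm_eq_dotProduct, dotProduct, Matrix.mulVec, Finset.mul_sum]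
  have h2 (i j : Fin p) : x i * (S i j * y j) =
      (S 0 0 - 1) * ((if i = 0 then x i else 0) * (if j = 0 then y j else 0)) +
      (if i = 0 then x i else 0) * (b j * y j) + (b i * x i) * (if j = 0 then y j else 0) +
      (if i = j then x i * y j else 0) := by
    rw [hij]
    split_ifs <;> ring
  have h3 (u w : EuclideanSpace ℝ (Fin p)) : inner ℝ u w = ∑ i, u i * w i := by
    simp [PiLp.inner_apply, mul_comm]
  rw [h1]
  simp_rw [h2, Finset.sum_add_distrib, ← Finset.mul_sum, ← Finset.sum_mul]
  simp [h3]
  ring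

/-- The vector of covariances between the first covariate and the others. It is also the vector of
coefficients of the regression of the first covariate on the others. -/
noncomputable def Param.covVec (θ : Param p) : EuclideanSpace ℝ (Fin p) :=
  WithLp.toLp 2 fun j => if j = 0 then 0 else θ.cov 0 j

/-- The vector of covariances between the response and the covariates other than the first, for a
covariance matrix with an identity block. -/
noncomputable def Param.respVec (θ : Param p) : EuclideanSpace ℝ (Fin p) :=
  θ.coef - θ.coef 0 • EuclideanSpace.single 0 1 + θ.coef 0 • θ.covVec

variable {θ : Param p} {M M₁ M₂ : ℝ}

@[simp] lemma Param.covVec_zero : θ.covVec 0 = 0 := by simp [Param.covVec]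

@[simp] lemma Param.respVec_zero : θ.respVec 0 = 0 := by simp [Param.respVec]

lemma inner_single_zero (x : EuclideanSpace ℝ (Fin p)) :
    inner ℝ x (EuclideanSpace.single 0 1) = x 0 := by
  simp [EuclideanSpace.inner_single_right]

lemma paramSpace_isHermitian (h : θ ∈ paramSpace p M M₁ M₂) : θ.cov.IsHermitian := h.1.1

lemma paramSpace_covForm_bounds (h : θ ∈ paramSpace p M M₁ M₂) (x : EuclideanSpace ℝ (Fin p)) :
    M⁻¹ * ‖x‖ ^ 2 ≤ covForm θ.cov x x ∧ covForm θ.cov x x ≤ M * ‖x‖ ^ 2 :=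
  covForm_self_bounds x h.1.1 h.1.2

lemma paramSpace_posSemidef (hM : 0 < M) (h : θ ∈ paramSpace p M M₁ M₂) : θ.cov.PosSemidef :=
  posSemidef_of_eigenvalues h.1.1 (inv_nonneg.2 hM.le) fun i => (h.1.2 i).1

lemma paramSpace_covForm (h : θ ∈ paramSpace p M M₁ M₂) (x y : EuclideanSpace ℝ (Fin p)) :
    covForm θ.cov x y = (θ.cov 0 0 - 1) * x 0 * y 0 + x 0 * inner ℝ θ.covVec y +
      y 0 * inner ℝ θ.covVec x + inner ℝ x y := by
  refine covForm_block (by simp) (fun j hj => ?_) h.2.1 x y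
  have := (paramSpace_isHermitian h).apply 0 j
  simp [Param.covVec, hj] at this ⊢
  exact this

lemma covForm_single_eq_inner_covVec (h : θ ∈ paramSpace p M M₁ M₂)
    {w : EuclideanSpace ℝ (Fin p)} (hw : w 0 = 0) :
    covForm θ.cov (EuclideanSpace.single 0 1) w = inner ℝ θ.covVec w := by
  rw [paramSpace_covForm h]
  simp [hw, EuclideanSpace.inner_single_left]

lemma covForm_coef_eq_inner_respVec (h : θ ∈ paramSpace p M M₁ M₂)
    {w : EuclideanSpace ℝ (Fin p)} (hw : w 0 = 0) :
    covForm θ.cov θ.coef w = inner ℝ θ.respVec w := by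
  rw [paramSpace_covForm h, Param.respVec]
  simp [hw, EuclideanSpace.inner_single_left, inner_add_left, inner_sub_left,
    real_inner_smul_left]
  ring

/-- The residual variance of the regression of the first covariate on the others. -/
noncomputable def Param.residVar (θ : Param p) : ℝ := θ.cov 0 0 - ‖θ.covVec‖ ^ 2

lemma inv_le_residVar (hM : 0 < M) (h : θ ∈ paramSpace p M M₁ M₂) : M⁻¹ ≤ θ.residVar := by
  have h1 := (paramSpace_covForm_bounds h (EuclideanSpace.single 0 1 - θ.covVec)).1
  have h2 : covForm θ.cov (EuclideanSpace.single 0 1 - θ.covVec)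
      (EuclideanSpace.single 0 1 - θ.covVec) = θ.residVar := by
    rw [paramSpace_covForm h, Param.residVar]
    simp [inner_sub_right, inner_single_zero, norm_sub_sq_real,
      EuclideanSpace.inner_single_left]
    ring
  have h3 : 1 ≤ ‖EuclideanSpace.single (0 : Fin p) (1 : ℝ) - θ.covVec‖ ^ 2 := by
    have := PiLp.norm_apply_le (EuclideanSpace.single (0 : Fin p) (1 : ℝ) - θ.covVec) 0
    simp at this
    nlinarith
  rw [h2] at h1
  have : 0 < M⁻¹ := inv_pos.2 hM
  nlinarith

/-- Covariance of response and first covariate, corrected for the other covariates, identifies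
the first coefficient. -/
lemma covForm_coef_sub_inner (h : θ ∈ paramSpace p M M₁ M₂) :
    covForm θ.cov θ.coef (EuclideanSpace.single 0 1) - inner ℝ θ.covVec θ.respVec =
      θ.beta * θ.residVar := by
  rw [paramSpace_covForm h, Param.residVar, Param.beta, Param.respVec]
  simp [inner_add_right, inner_sub_right, inner_single_zero, real_inner_smul_right]
  ring

lemma norm_covVec_le (hM : 1 < M) (h : θ ∈ paramSpace p M M₁ M₂) : ‖θ.covVec‖ ≤ M := by
  have h1 := inv_le_residVar (by linarith) h
  have h2 := (paramSpace_covForm_bounds h (EuclideanSpace.single 0 1)).2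
  rw [covForm_single_single] at h2
  simp only [PiLp.norm_single, norm_one, one_pow, mul_one] at h2
  have h3 : 0 < M⁻¹ := inv_pos.2 (by linarith)
  rw [Param.residVar] at h1
  refine le_of_sq_le_sq ?_ (by linarith)
  nlinarith

lemma abs_beta_le (h : θ ∈ paramSpace p M M₁ M₂) : |θ.beta| ≤ M₂ :=
  (PiLp.norm_apply_le θ.coef 0).trans h.2.2.2.2

lemma norm_respVec_le (hM : 1 < M) (hM₂ : 0 < M₂) (h : θ ∈ paramSpace p M M₁ M₂) :
    ‖θ.respVec‖ ≤ (M + 1) * M₂ := by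
  have h1 : ‖θ.coef - θ.coef 0 • EuclideanSpace.single 0 1‖ ≤ M₂ := by
    refine le_trans ?_ h.2.2.2.2
    refine le_of_sq_le_sq ?_ (norm_nonneg _)
    rw [norm_sub_sq_real, real_inner_smul_right, inner_single_zero, norm_smul]
    simp only [PiLp.norm_single, norm_one, mul_one, Real.norm_eq_abs, sq_abs]
    nlinarith [sq_nonneg (θ.coef 0)]
  have h2 : ‖θ.coef 0 • θ.covVec‖ ≤ M₂ * M := by
    rw [norm_smul]
    exact mul_le_mul (abs_beta_le h) (norm_covVec_le hM h) (norm_nonneg _) hM₂.le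
  calc _ ≤ _ := norm_add_le _ _
    _ ≤ M₂ + M₂ * M := add_le_add h1 h2
    _ = _ := by ring

/-- The first row of the inverse has the sparsity pattern of the regression coefficients of the
first covariate. -/
lemma inv_apply_zero_of_block {S : Matrix (Fin p) (Fin p) ℝ} (hdet : IsUnit S.det)
    (hS : ∀ i j : Fin p, i ≠ 0 → j ≠ 0 → S i j = if i = j then 1 else 0) (j : Fin p)
    (hj : j ≠ 0) : S⁻¹ 0 0 ≠ 0 ∧ S⁻¹ 0 j = -(S⁻¹ 0 0 * S 0 j) := by
  have hmul := Matrix.nonsing_inv_mul S hdet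
  have hrel (k : Fin p) (hk : k ≠ 0) : S⁻¹ 0 k = -(S⁻¹ 0 0 * S 0 k) := by
    have h1 := congrFun (congrFun hmul 0) k
    rw [Matrix.mul_apply, ← Finset.add_sum_erase _ _ (Finset.mem_univ (0 : Fin p)),
      Matrix.one_apply_ne hk.symm] at h1
    have h2 : ∑ i ∈ Finset.univ.erase (0 : Fin p), S⁻¹ 0 i * S i k = S⁻¹ 0 k := by
      rw [Finset.sum_eq_single k]
      · simp [hS k k hk hk]
      · intro i hi hik
        rw [hS i k (Finset.ne_of_mem_erase hi) hk, if_neg hik, mul_zero]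
      · simp [hk]
    linarith
  refine ⟨fun h0 => ?_, hrel j hj⟩
  have h1 := congrFun (congrFun hmul 0) 0
  rw [Matrix.mul_apply, Finset.sum_eq_zero] at h1
  · simp at h1
  · intro i _
    by_cases hi : i = 0
    · simp [hi, h0]
    · simp [hrel i hi, h0]

lemma card_support_covVec_le (hM : 0 < M) {s : ℕ} (h : θ ∈ sparseSpace p M M₁ M₂ s) :
    (Finset.univ.filter fun j => θ.covVec j ≠ 0).card ≤ s := by
  refine le_trans ?_ h.2
  rw [Param.rowSparsity, ← Set.ncard_coe_finset]
  refine Set.ncard_le_ncard (fun j hj => ?_) (Set.toFinite _)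
  simp only [Finset.coe_filter, Finset.mem_univ, true_and, Set.mem_ofPred_eq] at hj ⊢
  have hj0 : j ≠ 0 := fun h0 => hj (by simp [h0])
  obtain ⟨h1, h2⟩ := inv_apply_zero_of_block
    (isUnit_det_of_covForm (inv_pos.2 hM) fun x => (paramSpace_covForm_bounds h.1 x).1) h.1.2.1 j hj0
  rw [h2, neg_ne_zero]
  simp only [Param.covVec, hj0, if_false] at hj
  exact mul_ne_zero h1 hj

end Block

/-! ### The thresholded pilot estimators and the bias correction -/

section Estimator

variable {p : ℕ} [NeZero p] {ι : Type*} [Fintype ι]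

/-- The empirical covariance of two linear forms of the observations. -/
noncomputable def crossMean (c : ℝ) (z : EuclideanSpace ℝ (Fin p)) (c' : ℝ)
    (z' : EuclideanSpace ℝ (Fin p)) (x : ι → ℝ × EuclideanSpace ℝ (Fin p)) : ℝ :=
  (∑ i, linForm c z (x i) * linForm c' z' (x i)) / Fintype.card ι

/-- The empirical covariances between a linear form and the covariates other than the first, hard
thresholded at level `2 lam`. -/
noncomputable def thrVec (lam c : ℝ) (z : EuclideanSpace ℝ (Fin p))
    (x : ι → ℝ × EuclideanSpace ℝ (Fin p)) : EuclideanSpace ℝ (Fin p) :=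
  WithLp.toLp 2 fun j =>
    if j ≠ 0 ∧ 2 * lam < |crossMean c z 0 (EuclideanSpace.single j 1) x| then
      crossMean c z 0 (EuclideanSpace.single j 1) x else 0

/-- The estimator of the first coefficient, computed from pilot estimates `b` and `v` of the vectors
`covVec` and `respVec` and from a fresh sample. The error of the pilot estimates enters only through
the products `⟨b - covVec, v - respVec⟩` and `‖b - covVec‖²`. -/
noncomputable def betaEst (M : ℝ) (b v : EuclideanSpace ℝ (Fin p))
    (x : ι → ℝ × EuclideanSpace ℝ (Fin p)) : ℝ :=
  (crossMean 1 0 0 (EuclideanSpace.single 0 1 - b) x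
      - crossMean 0 (EuclideanSpace.single 0 1) 0 v x + inner ℝ b v) /
    max (crossMean 0 (EuclideanSpace.single 0 1) 0 (EuclideanSpace.single 0 1 - (2 : ℝ) • b) x
      + ‖b‖ ^ 2) M⁻¹

/-- Thresholding on the event that all coordinates are estimated up to `lam`. -/
lemma thrVec_spec {lam c : ℝ} {z u : EuclideanSpace ℝ (Fin p)}
    {x : ι → ℝ × EuclideanSpace ℝ (Fin p)} (hu0 : u 0 = 0)
    (h : ∀ j, j ≠ 0 → |crossMean c z 0 (EuclideanSpace.single j 1) x - u j| ≤ lam)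
    (hlam : 0 ≤ lam) :
    thrVec lam c z x 0 = 0 ∧ (∀ j, |thrVec lam c z x j - u j| ≤ 3 * lam) ∧
      (∀ j, |thrVec lam c z x j| ≤ 2 * |u j|) := by
  have key (j) : |thrVec lam c z x j - u j| ≤ 3 * lam ∧ |thrVec lam c z x j| ≤ 2 * |u j| := by
    by_cases hj : j = 0
    · simp [thrVec, hj, hu0, hlam]
    have h1 := abs_le.1 (h j hj)
    have habs := abs_sub_abs_le_abs_sub (crossMean c z 0 (EuclideanSpace.single j 1) x) (u j)
    have habs' := abs_sub_abs_le_abs_sub (u j) (crossMean c z 0 (EuclideanSpace.single j 1) x)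
    rw [abs_sub_comm (u j)] at habs'
    have h2 := h j hj
    simp only [thrVec, ne_eq, hj, not_false_eq_true, true_and]
    split_ifs with ht
    · constructor <;> linarith
    · rw [not_lt] at ht
      simp only [zero_sub, abs_neg, abs_zero]
      constructor <;> [linarith; positivity]
  exact ⟨by simp [thrVec], fun j => (key j).1, fun j => (key j).2⟩

lemma abs_inner_le_of_sparse {x y : EuclideanSpace ℝ (Fin p)} {r : ℝ} {s : ℕ} {T : Finset (Fin p)}
    (hT : T.card ≤ s) (hx : ∀ j ∉ T, x j = 0) (hxr : ∀ j, |x j| ≤ r) (hyr : ∀ j, |y j| ≤ r) :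
    |inner ℝ x y| ≤ s * r ^ 2 := by
  have h1 : inner ℝ x y = ∑ j ∈ T, x j * y j := by
    rw [PiLp.inner_apply, Finset.sum_subset T.subset_univ]
    · simp [mul_comm]
    · intro j _ hj
      simp [hx j hj]
  have hr : 0 ≤ r := (abs_nonneg _).trans (hxr 0)
  rw [h1]
  calc |∑ j ∈ T, x j * y j| ≤ ∑ j ∈ T, |x j * y j| := Finset.abs_sum_le_sum_abs _ _
    _ ≤ ∑ _j ∈ T, r ^ 2 := Finset.sum_le_sum fun j _ => by
        rw [abs_mul, sq]; exact mul_le_mul (hxr j) (hyr j) (abs_nonneg _) hr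
    _ = T.card * r ^ 2 := by simp
    _ ≤ _ := by gcongr

/-- Accuracy of the estimator, given the accuracy of the empirical covariances. -/
lemma abs_betaEst_sub_le {M M₁ M₂ : ℝ} (hM : 1 < M) {s : ℕ} {θ : Param p}
    (hθ : θ ∈ sparseSpace p M M₁ M₂ s) {b v : EuclideanSpace ℝ (Fin p)} {lam ε : ℝ}
    {x : ι → ℝ × EuclideanSpace ℝ (Fin p)} (hb0 : b 0 = 0) (hv0 : v 0 = 0)
    (hb : ∀ j, |b j - θ.covVec j| ≤ 3 * lam) (hv : ∀ j, |v j - θ.respVec j| ≤ 3 * lam)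
    (hbs : ∀ j, |b j| ≤ 2 * |θ.covVec j|)
    (h1 : |crossMean 1 0 0 (EuclideanSpace.single 0 1 - b) x -
      θ.cross 1 0 0 (EuclideanSpace.single 0 1 - b)| ≤ ε)
    (h2 : |crossMean 0 (EuclideanSpace.single 0 1) 0 v x -
      θ.cross 0 (EuclideanSpace.single 0 1) 0 v| ≤ ε)
    (h3 : |crossMean 0 (EuclideanSpace.single 0 1) 0
        (EuclideanSpace.single 0 1 - (2 : ℝ) • b) x -
      θ.cross 0 (EuclideanSpace.single 0 1) 0 (EuclideanSpace.single 0 1 - (2 : ℝ) • b)| ≤ ε) :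
    |betaEst M b v x - θ.beta| ≤ M * (1 + M₂) * (2 * ε + 9 * (s * lam ^ 2)) := by
  have hM0 : 0 < M := by linarith
  have hsp (y : EuclideanSpace ℝ (Fin p)) (hy : ∀ j, |y j| ≤ 3 * lam) :
      |inner ℝ (b - θ.covVec) y| ≤ 9 * (s * lam ^ 2) := by
    have := abs_inner_le_of_sparse (card_support_covVec_le hM0 hθ) (x := b - θ.covVec) (y := y)
      (r := 3 * lam) (fun j hj => ?_) (fun j => hb j) hy
    · linarith
    · simp only [Finset.mem_filter, Finset.mem_univ, true_and, not_not] at hj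
      have := hbs j
      rw [hj, abs_zero, mul_zero] at this
      simp [hj, abs_eq_zero.1 (le_antisymm this (abs_nonneg _))]
  have e1 : θ.cross 1 0 0 (EuclideanSpace.single 0 1 - b) =
      covForm θ.cov θ.coef (EuclideanSpace.single 0 1) - inner ℝ θ.respVec b := by
    simp [Param.cross, covForm_sub_right, covForm_coef_eq_inner_respVec hθ.1 hb0]
  have e2 : θ.cross 0 (EuclideanSpace.single 0 1) 0 v = inner ℝ θ.covVec v := by
    simp [Param.cross, covForm_single_eq_inner_covVec hθ.1 hv0]
  have e3 : θ.cross 0 (EuclideanSpace.single 0 1) 0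
      (EuclideanSpace.single 0 1 - (2 : ℝ) • b) = θ.cov 0 0 - 2 * inner ℝ θ.covVec b := by
    simp [Param.cross, covForm_sub_right, covForm_smul_right, covForm_single_single,
      covForm_single_eq_inner_covVec hθ.1 hb0]
  have hid := covForm_coef_sub_inner hθ.1
  have bias1 := hsp (v - θ.respVec) hv
  have bias2 := hsp (b - θ.covVec) hb
  rw [inner_sub_left, inner_sub_right, inner_sub_right, real_inner_comm θ.respVec b] at bias1
  rw [real_inner_self_eq_norm_sq, norm_sub_sq_real, real_inner_comm] at bias2
  rw [e1] at h1
  rw [e2] at h2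
  rw [e3] at h3
  rw [betaEst]
  set mu := crossMean 1 0 0 (EuclideanSpace.single 0 1 - b) x
      - crossMean 0 (EuclideanSpace.single 0 1) 0 v x + inner ℝ b v with hmu
  set ka := crossMean 0 (EuclideanSpace.single 0 1) 0
      (EuclideanSpace.single 0 1 - (2 : ℝ) • b) x + ‖b‖ ^ 2 with hka
  set r := 2 * ε + 9 * (s * lam ^ 2)
  have hε : 0 ≤ ε := (abs_nonneg _).trans h2
  rw [abs_le] at h1 h2 h3 bias1 bias2
  have hmu' : |mu - θ.beta * θ.residVar| ≤ r := by
    rw [← hid, abs_le]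
    constructor <;> linarith
  have hka' : |ka - θ.residVar| ≤ r := by
    rw [Param.residVar, abs_le]
    constructor <;> linarith
  have hres := inv_le_residVar hM0 hθ.1
  have hK : |max ka M⁻¹ - θ.residVar| ≤ r := by
    rw [abs_le] at hka' ⊢
    constructor
    · linarith [le_max_left ka M⁻¹]
    · rcases max_cases ka M⁻¹ with h | h <;> linarith
  have hKM : M⁻¹ ≤ max ka M⁻¹ := le_max_right _ _
  have hKpos : 0 < max ka M⁻¹ := (inv_pos.2 hM0).trans_le hKM
  have hnum : |mu - θ.beta * max ka M⁻¹| ≤ (1 + M₂) * r := by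
    calc |mu - θ.beta * max ka M⁻¹|
        = |(mu - θ.beta * θ.residVar) - θ.beta * (max ka M⁻¹ - θ.residVar)| := by ring_nf
      _ ≤ |mu - θ.beta * θ.residVar| + |θ.beta| * |max ka M⁻¹ - θ.residVar| := by
        rw [← abs_mul]; exact abs_sub _ _
      _ ≤ r + M₂ * r := add_le_add hmu' (mul_le_mul (abs_beta_le hθ.1) hK (abs_nonneg _)
        ((abs_nonneg _).trans (abs_beta_le hθ.1)))
      _ = _ := by ring
  have e : mu / max ka M⁻¹ - θ.beta = (mu - θ.beta * max ka M⁻¹) * (max ka M⁻¹)⁻¹ := by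
    field_simp
  rw [e, abs_mul, abs_of_pos (inv_pos.2 hKpos), mul_comm M, mul_assoc, mul_comm M, ← mul_assoc]
  refine mul_le_mul hnum ?_ (inv_pos.2 hKpos).le ((abs_nonneg _).trans hnum)
  rw [inv_le_comm₀ hKpos hM0]
  exact hKM

end Estimator

/-! ### Coverage of the sample splitting interval -/

lemma measurable_crossMean {p : ℕ} {ι : Type*} [Fintype ι] {Ω : Type*} [MeasurableSpace Ω] (c c' : ℝ)
    {z z' : Ω → EuclideanSpace ℝ (Fin p)} (hz : Measurable z) (hz' : Measurable z')
    {x : Ω → ι → ℝ × EuclideanSpace ℝ (Fin p)} (hx : Measurable x) :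
    Measurable fun ω => crossMean c (z ω) c' (z' ω) (x ω) := by
  simp only [crossMean, linForm_apply]
  fun_prop

section Coverage

variable {p : ℕ} [NeZero p] {ι κ : Type*} [Fintype ι] [Fintype κ]

lemma measurable_thrVec (lam c : ℝ) (z : EuclideanSpace ℝ (Fin p)) :
    Measurable fun x : ι → ℝ × EuclideanSpace ℝ (Fin p) => thrVec lam c z x := by
  have hm (j : Fin p) : Measurable fun x : ι → ℝ × EuclideanSpace ℝ (Fin p) =>
      crossMean c z 0 (EuclideanSpace.single j 1) x :=
    measurable_crossMean c 0 measurable_const measurable_const measurable_id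
  refine (WithLp.measurable_toLp 2 _).comp (measurable_pi_lambda _ fun j => ?_)
  refine Measurable.ite ?_ (hm j) measurable_const
  exact (MeasurableSet.const _).inter (measurableSet_lt measurable_const (hm j).abs)

lemma measurable_betaEst {Ω : Type*} [MeasurableSpace Ω] (M : ℝ)
    {b v : Ω → EuclideanSpace ℝ (Fin p)} (hb : Measurable b) (hv : Measurable v)
    {x : Ω → ι → ℝ × EuclideanSpace ℝ (Fin p)} (hx : Measurable x) :
    Measurable fun ω => betaEst M (b ω) (v ω) (x ω) := by
  unfold betaEst
  have h1 := measurable_crossMean 1 0 (z := fun _ => 0)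
    (z' := fun ω => EuclideanSpace.single 0 1 - b ω) measurable_const (by fun_prop) hx
  have h2 := measurable_crossMean 0 0 (z := fun _ => EuclideanSpace.single 0 1)
    (z' := v) measurable_const hv hx
  have h3 := measurable_crossMean 0 0 (z := fun _ => EuclideanSpace.single 0 1)
    (z' := fun ω => EuclideanSpace.single 0 1 - (2 : ℝ) • b ω) measurable_const (by fun_prop) hx
  fun_prop

/-- The estimator with pilot estimates from the sample `x` and debiasing on the sample `y`. -/
noncomputable def splitEst (M lam : ℝ) (x : ι → ℝ × EuclideanSpace ℝ (Fin p))
    (y : κ → ℝ × EuclideanSpace ℝ (Fin p)) : ℝ :=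
  betaEst M (thrVec lam 0 (EuclideanSpace.single 0 1) x) (thrVec lam 1 0 x) y

lemma measurable_splitEst {Ω : Type*} [MeasurableSpace Ω] (M lam : ℝ)
    {x : Ω → ι → ℝ × EuclideanSpace ℝ (Fin p)} (hx : Measurable x)
    {y : Ω → κ → ℝ × EuclideanSpace ℝ (Fin p)} (hy : Measurable y) :
    Measurable fun ω => splitEst M lam (x ω) (y ω) :=
  measurable_betaEst M ((measurable_thrVec lam 0 _).comp hx) ((measurable_thrVec lam 1 _).comp hx)
    hy

/-- A bound for the variances of the linear forms that enter the estimator. -/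
noncomputable def varBound (M M₁ M₂ : ℝ) : ℝ :=
  M₁ ^ 2 + M * (1 + 4 * M + 2 * ((M + 1) * M₂) + M₂) ^ 2

lemma cross_self_le {M M₁ M₂ : ℝ} (hM : 1 < M) {θ : Param p}
    (h : θ ∈ paramSpace p M M₁ M₂) {c : ℝ} (hc : |c| ≤ 1) {z : EuclideanSpace ℝ (Fin p)}
    (hz : ‖z‖ ≤ 1 + 4 * M + 2 * ((M + 1) * M₂)) :
    θ.cross c z c z ≤ varBound M M₁ M₂ := by
  have h1 := (paramSpace_covForm_bounds h (z + c • θ.coef)).2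
  have h2 : ‖z + c • θ.coef‖ ≤ 1 + 4 * M + 2 * ((M + 1) * M₂) + M₂ := by
    refine (norm_add_le _ _).trans (add_le_add hz ?_)
    rw [norm_smul, Real.norm_eq_abs]
    calc |c| * ‖θ.coef‖ ≤ 1 * M₂ := mul_le_mul hc h.2.2.2.2 (norm_nonneg _) zero_le_one
      _ = M₂ := one_mul _
  have h3 : c * c * θ.sigma ^ 2 ≤ M₁ ^ 2 := by
    have h4 : c * c ≤ 1 := by
      have := abs_mul_abs_self c
      nlinarith [abs_nonneg c]
    have h5 : θ.sigma ^ 2 ≤ M₁ ^ 2 := pow_le_pow_left₀ h.2.2.1 h.2.2.2.1 2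
    nlinarith [sq_nonneg θ.sigma]
  rw [Param.cross, varBound]
  have h6 : M * ‖z + c • θ.coef‖ ^ 2 ≤ M * (1 + 4 * M + 2 * ((M + 1) * M₂) + M₂) ^ 2 := by
    gcongr
  linarith

lemma varBound_pos {M M₁ M₂ : ℝ} (hM : 1 < M) (hM₂ : 0 < M₂) : 0 < varBound M M₁ M₂ := by
  unfold varBound; positivity

/-- The failure probability of the estimator based on two independent samples. -/
lemma measure_splitEst_deviation_le [Nonempty ι] [Nonempty κ] {M M₁ M₂ : ℝ} (hM : 1 < M)
    (hM₂ : 0 < M₂) {s : ℕ} {θ : Param p} (hθ : θ ∈ sparseSpace p M M₁ M₂ s) {A A' q q' lam ε : ℝ}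
    (hA : 0 ≤ A)
    (hq : 0 ≤ q) (hq1 : q ≤ 1) (hq' : 0 ≤ q') (hq1' : q' ≤ 1)
    (hlam : lam = 8 * varBound M M₁ M₂ * (4 + A) * q)
    (hε : ε = 8 * varBound M M₁ M₂ * (4 + A') * q') :
    ((Measure.pi fun _ : ι => θ.obsLaw).prod (Measure.pi fun _ : κ => θ.obsLaw))
        {d | M * (1 + M₂) * (2 * ε + 9 * (s * lam ^ 2)) < |splitEst M lam d.1 d.2 - θ.beta|} ≤
      ENNReal.ofReal (4 * p * Real.exp (-(A * Fintype.card ι * q ^ 2)) +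
        6 * Real.exp (-(A' * Fintype.card κ * q' ^ 2))) := by
  set V := varBound M M₁ M₂ with hVdef
  have hV : 0 < V := varBound_pos hM hM₂
  have hM0 : 0 < M := by linarith
  have hPSD := paramSpace_posSemidef hM0 hθ.1
  have hlam0 : 0 ≤ lam := by rw [hlam]; positivity
  have hB : 0 ≤ 2 * ((M + 1) * M₂) := by positivity
  set P := Measure.pi fun _ : ι => θ.obsLaw
  set P' := Measure.pi fun _ : κ => θ.obsLaw
  set e0 : EuclideanSpace ℝ (Fin p) := EuclideanSpace.single 0 1
  have he0 : ‖e0‖ = 1 := by simp [e0]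
  -- The event that some coordinate of the pilot estimates is inaccurate.
  set B : Fin p → Set (ι → ℝ × EuclideanSpace ℝ (Fin p)) := fun j =>
    {x | lam ≤ |crossMean 0 e0 0 (EuclideanSpace.single j 1) x -
        θ.cross 0 e0 0 (EuclideanSpace.single j 1)|} ∪
    {x | lam ≤ |crossMean 1 0 0 (EuclideanSpace.single j 1) x -
        θ.cross 1 0 0 (EuclideanSpace.single j 1)|} with hBdef
  have hBmeas (j) : MeasurableSet (B j) := by
    refine MeasurableSet.union ?_ ?_ <;> refine measurableSet_le measurable_const ?_
    · exact ((measurable_crossMean 0 0 measurable_const measurable_const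
        measurable_id).sub_const _).abs
    · exact ((measurable_crossMean 1 0 measurable_const measurable_const
        measurable_id).sub_const _).abs
  have hBprob (j) : P (B j) ≤ ENNReal.ofReal (4 * Real.exp (-(A * Fintype.card ι * q ^ 2))) := by
    have hj : ‖EuclideanSpace.single j (1 : ℝ)‖ ≤ 1 + 4 * M + 2 * ((M + 1) * M₂) := by
      simp only [PiLp.norm_single, norm_one]; linarith
    have h1 := measure_cross_deviation_le (ι := ι) (θ := θ) (c := 0) (c' := 0) (z := e0)
      (z' := EuclideanSpace.single j 1) (A := A) hPSD hV
      (cross_self_le hM hθ.1 (by simp) (by rw [he0]; linarith))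
      (cross_self_le hM hθ.1 (by simp) hj) hq hq1
    have h2 := measure_cross_deviation_le (ι := ι) (θ := θ) (c := 1) (c' := 0) (z := 0)
      (z' := EuclideanSpace.single j 1) (A := A) hPSD hV
      (cross_self_le hM hθ.1 (by simp) (by rw [norm_zero]; linarith))
      (cross_self_le hM hθ.1 (by simp) hj) hq hq1
    rw [← hlam] at h1 h2
    have h3 := (measureReal_union_le (μ := P) _ _).trans (add_le_add h1 h2)
    rw [← ofReal_measureReal]
    refine ENNReal.ofReal_le_ofReal (h3.trans (le_of_eq (by ring)))
  have hU : P (⋃ j, B j) ≤ ENNReal.ofReal (4 * p * Real.exp (-(A * Fintype.card ι * q ^ 2))) := by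
    refine (measure_iUnion_le _).trans ?_
    rw [tsum_fintype]
    refine (Finset.sum_le_sum fun j _ => hBprob j).trans (le_of_eq ?_)
    rw [Finset.sum_const, Finset.card_univ, Fintype.card_fin, nsmul_eq_mul,
      ← ENNReal.ofReal_natCast, ← ENNReal.ofReal_mul (by positivity)]
    congr 1; ring
  set bad : Set ((ι → ℝ × EuclideanSpace ℝ (Fin p)) × (κ → ℝ × EuclideanSpace ℝ (Fin p))) :=
    {d | M * (1 + M₂) * (2 * ε + 9 * (s * lam ^ 2)) < |splitEst M lam d.1 d.2 - θ.beta|}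
    with hbad
  have hbadm : MeasurableSet bad :=
    measurableSet_lt measurable_const
      ((measurable_splitEst M lam measurable_fst measurable_snd).sub_const _).abs
  -- Outside that event, the debiasing step succeeds with high probability.
  have hslice (x) (hx : x ∉ ⋃ j, B j) : P' (Prod.mk x ⁻¹' bad) ≤
      ENNReal.ofReal (6 * Real.exp (-(A' * Fintype.card κ * q' ^ 2))) := by
    simp only [Set.mem_iUnion, not_exists, hBdef, Set.mem_union, not_or, Set.mem_ofPred_eq,
      not_le] at hx
    set b := thrVec lam 0 e0 x with hbdef
    set v := thrVec lam 1 0 x with hvdef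
    have hw (j : Fin p) (hj : j ≠ 0) :
        (EuclideanSpace.single j (1 : ℝ) : EuclideanSpace ℝ (Fin p)) 0 = 0 := by
      simp [Ne.symm hj]
    obtain ⟨hb0, hb1, hb2⟩ := thrVec_spec (c := 0) (z := e0) (x := x) (u := θ.covVec)
      (lam := lam) (by simp) (fun j hj => by
        have := (hx j).1.le
        have e : θ.cross 0 e0 0 (EuclideanSpace.single j 1) =
            covForm θ.cov e0 (EuclideanSpace.single j 1) := by simp [Param.cross]
        rwa [e, covForm_single_eq_inner_covVec hθ.1 (hw j hj), EuclideanSpace.inner_single_right,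
          conj_trivial, one_mul] at this) hlam0
    obtain ⟨hv0, hv1, hv2⟩ := thrVec_spec (c := 1) (z := 0) (x := x) (u := θ.respVec)
      (lam := lam) (by simp) (fun j hj => by
        have := (hx j).2.le
        have e : θ.cross 1 0 0 (EuclideanSpace.single j 1) =
            covForm θ.cov θ.coef (EuclideanSpace.single j 1) := by simp [Param.cross]
        rwa [e, covForm_coef_eq_inner_respVec hθ.1 (hw j hj), EuclideanSpace.inner_single_right,
          conj_trivial, one_mul] at this) hlam0
    rw [← hbdef] at hb0 hb1 hb2
    rw [← hvdef] at hv0 hv1 hv2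
    have hbn : ‖b‖ ≤ 2 * M := (norm_le_two_mul_of_coord hb2).trans
      (by linarith [norm_covVec_le hM hθ.1])
    have hvn : ‖v‖ ≤ 2 * ((M + 1) * M₂) := (norm_le_two_mul_of_coord hv2).trans
      (by linarith [norm_respVec_le hM hM₂ hθ.1])
    have c1 : ‖e0 - b‖ ≤ 1 + 4 * M + 2 * ((M + 1) * M₂) :=
      (norm_sub_le _ _).trans (by linarith)
    have c2 : ‖e0 - (2 : ℝ) • b‖ ≤ 1 + 4 * M + 2 * ((M + 1) * M₂) := by
      refine (norm_sub_le _ _).trans ?_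
      rw [norm_smul, Real.norm_ofNat]
      linarith
    have d1 := measure_cross_deviation_le (ι := κ) (θ := θ) (c := 1) (c' := 0) (z := 0)
      (z' := e0 - b) (A := A') hPSD hV
      (cross_self_le hM hθ.1 (by simp) (by rw [norm_zero]; linarith))
      (cross_self_le hM hθ.1 (by simp) c1) hq' hq1'
    have d2 := measure_cross_deviation_le (ι := κ) (θ := θ) (c := 0) (c' := 0) (z := e0)
      (z' := v) (A := A') hPSD hV
      (cross_self_le hM hθ.1 (by simp) (by rw [he0]; linarith))
      (cross_self_le hM hθ.1 (by simp) (by linarith)) hq' hq1'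
    have d3 := measure_cross_deviation_le (ι := κ) (θ := θ) (c := 0) (c' := 0) (z := e0)
      (z' := e0 - (2 : ℝ) • b) (A := A') hPSD hV
      (cross_self_le hM hθ.1 (by simp) (by rw [he0]; linarith))
      (cross_self_le hM hθ.1 (by simp) c2) hq' hq1'
    rw [← hε] at d1 d2 d3
    have d4 := (measureReal_union_le (μ := P') _ _).trans
      (add_le_add ((measureReal_union_le (μ := P') _ _).trans (add_le_add d1 d2)) d3)
    rw [← ofReal_measureReal]
    refine ENNReal.ofReal_le_ofReal (le_trans (measureReal_mono fun y hy => ?_)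
      (d4.trans (le_of_eq (by ring))))
    by_contra hc
    simp only [Set.mem_union, Set.mem_ofPred_eq, not_or, not_le] at hc
    have hy' : M * (1 + M₂) * (2 * ε + 9 * (s * lam ^ 2)) < |splitEst M lam x y - θ.beta| := hy
    exact absurd hy' (not_lt.2 (abs_betaEst_sub_le hM hθ hb0 hv0 hb1 hv1 hb2 hc.1.1.le hc.1.2.le
      hc.2.le))
  rw [Measure.prod_apply hbadm, ENNReal.ofReal_add (by positivity) (by positivity)]
  calc ∫⁻ x, P' (Prod.mk x ⁻¹' bad) ∂P
      ≤ ∫⁻ x, ((⋃ j, B j).indicator 1 x +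
          ENNReal.ofReal (6 * Real.exp (-(A' * Fintype.card κ * q' ^ 2)))) ∂P := by
        refine lintegral_mono fun x => ?_
        by_cases hx : x ∈ ⋃ j, B j
        · rw [Set.indicator_of_mem hx]
          exact prob_le_one.trans le_self_add
        · rw [Set.indicator_of_notMem hx, zero_add]
          exact hslice x hx
    _ = P (⋃ j, B j) + ENNReal.ofReal (6 * Real.exp (-(A' * Fintype.card κ * q' ^ 2))) := by
        rw [lintegral_add_right _ measurable_const, lintegral_const, measure_univ, mul_one,
          lintegral_indicator_one (MeasurableSet.iUnion hBmeas)]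
    _ ≤ _ := by gcongr

end Coverage

/-- The upper bound: the interval around the sample splitting estimator whose length is the
deterministic accuracy bound is valid. -/
lemma minimaxLength_le {M M₁ M₂ α : ℝ} (hM : 1 < M) (hM₂ : 0 < M₂) (hα : 0 < α) (hα1 : α < 1) :
    ∃ C : ℝ, 0 < C ∧ ∀ (n p s s₁ : ℕ) [NeZero p], 2 ≤ n → 3 ≤ p → Real.log p / n ≤ 1 →
      minimaxLength n α (sparseSpace p M M₁ M₂ s) (sparseSpace p M M₁ M₂ s₁) ≤
        ENNReal.ofReal (C * (1 / √n + s * Real.log p / n)) := by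
  set V := varBound M M₁ M₂
  have hV : 0 < V := varBound_pos hM hM₂
  -- With these constants each of the two steps fails with probability at most `α / 2`.
  set A : ℝ := 4 * (1 + Real.log (8 / α)) with hA
  set A' : ℝ := 4 * Real.log (12 / α) with hA'
  have hl1 : 0 < Real.log (8 / α) := Real.log_pos (by rw [lt_div_iff₀ hα]; linarith)
  have hl2 : 0 < Real.log (12 / α) := Real.log_pos (by rw [lt_div_iff₀ hα]; linarith)
  have hA0 : 0 < A := by positivity
  have hA'0 : 0 < A' := by positivity
  set E := 8 * V * (4 + A')
  set L := 8 * V * (4 + A)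
  have hE : 0 < E := by positivity
  have hL : 0 < L := by positivity
  set C := 2 * (M * (1 + M₂) * (2 * E + 9 * L ^ 2))
  have hM0 : 0 < M := by linarith
  refine ⟨C, by positivity, fun n p s s₁ _ hn hp hlog => ?_⟩
  have hn0 : (0 : ℝ) < n := by exact_mod_cast (by omega : 0 < n)
  have hp3 : (3 : ℝ) ≤ p := by exact_mod_cast hp
  have hlogp : 1 ≤ Real.log p := by
    rw [Real.le_log_iff_exp_le (by linarith)]
    exact Real.exp_one_lt_three.le.trans hp3
  set q := √(Real.log p / n) with hq
  set q' := 1 / √(n : ℝ) with hq'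
  have hqsq : q ^ 2 = Real.log p / n := Real.sq_sqrt (by positivity)
  have hq'sq : q' ^ 2 = 1 / n := by rw [hq', div_pow, Real.sq_sqrt hn0.le, one_pow]
  have hq1 : q ≤ 1 := by rw [hq, Real.sqrt_le_left zero_le_one]; simpa using hlog
  have hq'0 : 0 ≤ q' := by positivity
  have hq'1 : q' ≤ 1 := by
    refine le_of_sq_le_sq ?_ zero_le_one
    rw [hq'sq, one_pow, div_le_one hn0]
    exact_mod_cast (by omega : 1 ≤ n)
  set R := M * (1 + M₂) * (2 * (E * q') + 9 * (s * (L * q) ^ 2)) with hR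
  have hR0 : 0 ≤ R := by positivity
  have hRC : 2 * R ≤ C * (1 / √n + s * Real.log p / n) := by
    rw [hR, mul_pow, hqsq]
    change _ ≤ 2 * (M * (1 + M₂) * (2 * E + 9 * L ^ 2)) * (q' + s * Real.log p / n)
    have h1 : 0 ≤ s * Real.log p / n := by positivity
    have h2 : 2 * (E * q') + 9 * (s * (L ^ 2 * (Real.log p / n))) ≤
        (2 * E + 9 * L ^ 2) * (q' + s * Real.log p / n) := by
      have h3 : 9 * (s * (L ^ 2 * (Real.log p / n))) = 9 * L ^ 2 * (s * Real.log p / n) := by ring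
      rw [h3]
      nlinarith [mul_nonneg hE.le h1, mul_nonneg (sq_nonneg L) hq'0]
    calc _ = 2 * (M * (1 + M₂)) * (2 * (E * q') + 9 * (s * (L ^ 2 * (Real.log p / n)))) := by ring
      _ ≤ 2 * (M * (1 + M₂)) * ((2 * E + 9 * L ^ 2) * (q' + s * Real.log p / n)) := by gcongr
      _ = _ := by ring
  -- The first half of the sample gives the pilot estimates.
  set est : Data n p → ℝ := fun D =>
    splitEst M (L * q) (fun i : {i : Fin n // i.val < n / 2} => D i)
      (fun i : {i : Fin n // ¬ i.val < n / 2} => D i) with hest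
  have hestm : Measurable est :=
    measurable_splitEst M (L * q) (by fun_prop) (by fun_prop)
  have hc1 : Fintype.card {i : Fin n // i.val < n / 2} = n / 2 := by
    rw [Fintype.card_subtype, Fin.card_filter_val_lt, min_eq_right (Nat.div_le_self _ _)]
  have hc2 : Fintype.card {i : Fin n // ¬ i.val < n / 2} = n - n / 2 := by
    rw [Fintype.card_subtype_compl, hc1, Fintype.card_fin]
  have hq4 : (n : ℝ) ≤ 4 * ((n / 2 : ℕ) : ℝ) := by exact_mod_cast (by omega : n ≤ 4 * (n / 2))
  have hq4' : (n : ℝ) ≤ 4 * ((n - n / 2 : ℕ) : ℝ) := by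
    exact_mod_cast (by omega : n ≤ 4 * (n - n / 2))
  have hne1 : Nonempty {i : Fin n // i.val < n / 2} := Fintype.card_pos_iff.1 (by omega)
  have hne2 : Nonempty {i : Fin n // ¬ i.val < n / 2} := Fintype.card_pos_iff.1 (by omega)
  have hvalid : ((fun D => est D - R, fun D => est D + R) : (Data n p → ℝ) × (Data n p → ℝ)) ∈
      validCI (n := n) α (sparseSpace p M M₁ M₂ s) := by
    refine ⟨hestm.sub_const _, hestm.add_const _, fun θ hθ => ?_⟩
    have hset : {D | est D - R ≤ θ.beta ∧ θ.beta ≤ est D + R} =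
        {D | R < |est D - θ.beta|}ᶜ := by
      ext D
      simp only [Set.mem_ofPred_eq, Set.mem_compl_iff, not_lt, abs_le]
      constructor <;> rintro ⟨h1, h2⟩ <;> constructor <;> linarith
    have hmeas : MeasurableSet {D | R < |est D - θ.beta|} :=
      measurableSet_lt measurable_const (hestm.sub_const _).abs
    have hdev := measure_splitEst_deviation_le (ι := {i : Fin n // i.val < n / 2})
      (κ := {i : Fin n // ¬ i.val < n / 2}) hM hM₂ hθ (A := A) (A' := A') hA0.le
      (Real.sqrt_nonneg _) hq1 hq'0 hq'1 (lam := L * q) (ε := E * q') rfl rfl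
    have hmp := measurePreserving_piEquivPiSubtypeProd (fun _ : Fin n => θ.obsLaw)
      (fun i => i.val < n / 2)
    have hlaw : θ.law n {D | R < |est D - θ.beta|} ≤ ENNReal.ofReal α := by
      have hpre : {D : Data n p | R < |est D - θ.beta|} =
          (MeasurableEquiv.piEquivPiSubtypeProd
            (fun _ : Fin n => ℝ × EuclideanSpace ℝ (Fin p)) (fun i => i.val < n / 2)) ⁻¹'
          {d | R < |splitEst M (L * q) d.1 d.2 - θ.beta|} := rfl
      rw [Param.law, hpre, hmp.measure_preimage_equiv]
      refine hdev.trans (ENNReal.ofReal_le_ofReal ?_)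
      rw [hc1, hc2, hqsq, hq'sq]
      have b1 : 4 * p * Real.exp (-(A * ((n / 2 : ℕ) : ℝ) * (Real.log p / n))) ≤ α / 2 := by
        have e1 : Real.log p + Real.log (8 / α) ≤
            A * ((n / 2 : ℕ) : ℝ) * (Real.log p / n) := by
          calc Real.log p + Real.log (8 / α)
              ≤ (1 + Real.log (8 / α)) * Real.log p := by nlinarith
            _ = A * (n / 4) * (Real.log p / n) := by rw [hA]; field_simp
            _ ≤ _ := by gcongr; linarith
        calc _ ≤ 4 * p * Real.exp (-(Real.log p + Real.log (8 / α))) := by gcongr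
          _ = α / 2 := by
            rw [neg_add, Real.exp_add, Real.exp_neg, Real.exp_neg, Real.exp_log (by linarith),
              Real.exp_log (by positivity)]
            field_simp
            norm_num
      have b2 : 6 * Real.exp (-(A' * ((n - n / 2 : ℕ) : ℝ) * (1 / n))) ≤ α / 2 := by
        have e1 : Real.log (12 / α) ≤ A' * ((n - n / 2 : ℕ) : ℝ) * (1 / n) := by
          calc Real.log (12 / α) = A' * (n / 4) * (1 / n) := by rw [hA']; field_simp
            _ ≤ _ := by gcongr; linarith
        calc _ ≤ 6 * Real.exp (-Real.log (12 / α)) := by gcongr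
          _ = α / 2 := by
            rw [Real.exp_neg, Real.exp_log (by positivity)]
            field_simp
            norm_num
      linarith
    change _ ≤ θ.law n {D | est D - R ≤ θ.beta ∧ θ.beta ≤ est D + R}
    rw [hset, prob_compl_eq_one_sub hmeas, ENNReal.ofReal_sub _ hα.le, ENNReal.ofReal_one]
    gcongr
  refine (iInf₂_le _ hvalid).trans (iSup₂_le fun θ _ => ?_)
  have hdiam (D : Data n p) : Metric.ediam (Set.Icc (est D - R) (est D + R)) =
      ENNReal.ofReal (2 * R) := by
    rw [Real.ediam_Icc]; congr 1; ring
  simp only [hdiam, lintegral_const, measure_univ, mul_one]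
  exact ENNReal.ofReal_le_ofReal hRC

/-! ### Gaussian regression alternatives with a standard Gaussian response -/

section Alternatives

variable {p : ℕ}

/-- The law of a standard Gaussian vector and an independent standard Gaussian variable. -/
noncomputable def baseLaw (p : ℕ) : Measure (EuclideanSpace ℝ (Fin p) × ℝ) :=
  (multivariateGaussian 0 1).prod (gaussianReal 0 1)

instance : IsProbabilityMeasure (baseLaw p) := by unfold baseLaw; infer_instance

/-- The map `(X, ξ) ↦ (X, ⟨g, X⟩ + √(1 - ‖g‖²) ξ)`. -/
noncomputable def regMap (g : EuclideanSpace ℝ (Fin p)) :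
    (EuclideanSpace ℝ (Fin p) × ℝ) →L[ℝ] (EuclideanSpace ℝ (Fin p) × ℝ) :=
  (ContinuousLinearMap.fst ℝ _ ℝ).prod
    ((innerSL ℝ g).comp (ContinuousLinearMap.fst ℝ _ ℝ) +
      √(1 - ‖g‖ ^ 2) • ContinuousLinearMap.snd ℝ _ ℝ)

@[simp] lemma regMap_apply (g : EuclideanSpace ℝ (Fin p)) (x : EuclideanSpace ℝ (Fin p) × ℝ) :
    regMap g x = (x.1, inner ℝ g x.1 + √(1 - ‖g‖ ^ 2) * x.2) := by
  simp [regMap]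

/-- The law of `(X, u)` where `X` is a standard Gaussian vector and `u` is standard Gaussian with
regression coefficients `g` on `X`. -/
noncomputable def regLaw (g : EuclideanSpace ℝ (Fin p)) :
    Measure (EuclideanSpace ℝ (Fin p) × ℝ) :=
  (baseLaw p).map (regMap g)

instance (g : EuclideanSpace ℝ (Fin p)) : IsProbabilityMeasure (regLaw g) := by
  unfold regLaw; exact Measure.isProbabilityMeasure_map (by fun_prop)

/-- The ratio of the densities of `N(m, v)` and `N(0, 1)`. -/
noncomputable def gaussRatio (v m u : ℝ) : ℝ :=
  (√v)⁻¹ * Real.exp (-(u - m) ^ 2 / (2 * v) + u ^ 2 / 2)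

lemma gaussRatio_nonneg (v m u : ℝ) : 0 ≤ gaussRatio v m u := by unfold gaussRatio; positivity

lemma gaussianReal_eq_withDensity (m : ℝ) {v : ℝ} (hv : 0 < v) :
    gaussianReal m v.toNNReal =
      (gaussianReal 0 1).withDensity fun u => ENNReal.ofReal (gaussRatio v m u) := by
  have hv' : v.toNNReal ≠ 0 := by simpa using hv
  rw [gaussianReal_of_var_ne_zero m hv', gaussianReal_of_var_ne_zero 0 one_ne_zero,
    ← withDensity_mul _ (measurable_gaussianPDF 0 1) (by unfold gaussRatio; fun_prop)]
  congr 1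
  ext u
  rw [Pi.mul_apply, gaussianPDF, gaussianPDF, ← ENNReal.ofReal_mul (gaussianPDFReal_nonneg _ _ _)]
  congr 1
  simp only [gaussianPDFReal, gaussRatio, Real.coe_toNNReal _ hv.le, NNReal.coe_one, mul_one,
    sub_zero]
  rw [Real.sqrt_mul (by positivity : (0 : ℝ) ≤ 2 * Real.pi) v, mul_inv]
  calc _ = (√(2 * Real.pi))⁻¹ * (√v)⁻¹ *
        Real.exp (-u ^ 2 / 2 + (-(u - m) ^ 2 / (2 * v) + u ^ 2 / 2)) := by ring_nf
    _ = _ := by rw [Real.exp_add]; ring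

lemma map_affine_gaussianReal (m : ℝ) {v : ℝ} (hv : 0 ≤ v) :
    (gaussianReal 0 1).map (fun ξ => m + √v * ξ) = gaussianReal m v.toNNReal := by
  have h : (fun ξ : ℝ => m + √v * ξ) = (fun x => m + x) ∘ fun ξ => √v * ξ := rfl
  rw [h, ← Measure.map_map (by fun_prop) (by fun_prop), gaussianReal_map_const_mul,
    gaussianReal_map_const_add]
  congr 1
  · simp
  · ext
    simp [Real.sq_sqrt hv, hv]

/-- The likelihood ratio of `regLaw g` with respect to `baseLaw p`. -/
noncomputable def likRatio (g : EuclideanSpace ℝ (Fin p)) (x : EuclideanSpace ℝ (Fin p) × ℝ) : ℝ :=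
  gaussRatio (1 - ‖g‖ ^ 2) (inner ℝ g x.1) x.2

lemma likRatio_nonneg (g : EuclideanSpace ℝ (Fin p)) (x : EuclideanSpace ℝ (Fin p) × ℝ) :
    0 ≤ likRatio g x := gaussRatio_nonneg _ _ _

lemma measurable_likRatio (g : EuclideanSpace ℝ (Fin p)) : Measurable (likRatio g) := by
  unfold likRatio gaussRatio; fun_prop

lemma regLaw_eq_withDensity {g : EuclideanSpace ℝ (Fin p)} (hg : ‖g‖ < 1) :
    regLaw g = (baseLaw p).withDensity fun x => ENNReal.ofReal (likRatio g x) := by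
  have hv : 0 < 1 - ‖g‖ ^ 2 := by nlinarith [norm_nonneg g]
  refine Measure.ext fun s hs => ?_
  have hm : Measurable fun x : EuclideanSpace ℝ (Fin p) × ℝ => ENNReal.ofReal (likRatio g x) :=
    (measurable_likRatio g).ennreal_ofReal
  rw [withDensity_apply _ hs, regLaw, Measure.map_apply (by fun_prop) hs, baseLaw,
    Measure.prod_apply ((by fun_prop : Measurable (regMap g)) hs), ← lintegral_indicator hs,
    lintegral_prod _ (hm.indicator hs).aemeasurable]
  refine lintegral_congr fun X => ?_
  have hsl : MeasurableSet (Prod.mk X ⁻¹' s) := measurable_prodMk_left hs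
  have h1 : Prod.mk X ⁻¹' (⇑(regMap g) ⁻¹' s) =
      (fun ξ => inner ℝ g X + √(1 - ‖g‖ ^ 2) * ξ) ⁻¹' (Prod.mk X ⁻¹' s) := by
    ext ξ; simp
  rw [h1, ← Measure.map_apply (by fun_prop) hsl, map_affine_gaussianReal _ hv.le,
    gaussianReal_eq_withDensity _ hv, withDensity_apply _ hsl, ← lintegral_indicator hsl]
  rfl

lemma charFunDual_gaussianReal_prod (L : StrongDual ℝ (ℝ × ℝ)) :
    charFunDual ((gaussianReal 0 1).prod (gaussianReal 0 1)) L =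
      Complex.exp (-((L (1, 0) ^ 2 + L (0, 1) ^ 2 : ℝ) : ℂ) / 2) := by
  have h1 : charFunDual (gaussianReal 0 1) (L.comp (.inl ℝ ℝ ℝ)) =
      charFun (gaussianReal 0 1) (L (1, 0)) := by
    rw [charFunDual_apply, charFun_apply]
    congr 1; ext x
    have : L (x, 0) = x * L (1, 0) := by
      rw [← smul_eq_mul, ← map_smul]; simp
    simp [this, mul_comm]
  have h2 : charFunDual (gaussianReal 0 1) (L.comp (.inr ℝ ℝ ℝ)) =
      charFun (gaussianReal 0 1) (L (0, 1)) := by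
    rw [charFunDual_apply, charFun_apply]
    congr 1; ext x
    have : L (0, x) = x * L (0, 1) := by
      rw [← smul_eq_mul, ← map_smul]; simp
    simp [this, mul_comm]
  rw [charFunDual_prod, h1, h2, charFun_gaussianReal, charFun_gaussianReal, ← Complex.exp_add]
  congr 1
  simp
  ring

/-- Under `regLaw g`, the response and a second linear form of the covariates are jointly
Gaussian. -/
lemma map_inner_regLaw {g g' : EuclideanSpace ℝ (Fin p)} (hg : ‖g‖ < 1) :
    (regLaw g).map (fun x => (x.2, inner ℝ g' x.1)) =
      ((gaussianReal 0 1).prod (gaussianReal 0 1)).map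
        (fun x => (x.1, inner ℝ g g' * x.1 + √(‖g'‖ ^ 2 - inner ℝ g g' ^ 2) * x.2)) := by
  have hv : 0 ≤ 1 - ‖g‖ ^ 2 := by nlinarith [norm_nonneg g]
  set ρ : ℝ := inner ℝ g g' with hρdef
  have hρ : 0 ≤ ‖g'‖ ^ 2 - ρ ^ 2 := by
    have h1 := abs_real_inner_le_norm g g'
    have h2 : |ρ| ≤ ‖g'‖ := h1.trans (mul_le_of_le_one_left (norm_nonneg _) hg.le)
    have h3 : ρ ^ 2 ≤ ‖g'‖ ^ 2 := by
      rw [← sq_abs]; exact pow_le_pow_left₀ (abs_nonneg _) h2 2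
    linarith
  set f : (EuclideanSpace ℝ (Fin p) × ℝ) →L[ℝ] (ℝ × ℝ) :=
    (ContinuousLinearMap.snd ℝ _ ℝ).prod ((innerSL ℝ g').comp (ContinuousLinearMap.fst ℝ _ ℝ))
  set k : (ℝ × ℝ) →L[ℝ] (ℝ × ℝ) := (ContinuousLinearMap.fst ℝ ℝ ℝ).prod
    (ρ • ContinuousLinearMap.fst ℝ ℝ ℝ + √(‖g'‖ ^ 2 - ρ ^ 2) • ContinuousLinearMap.snd ℝ ℝ ℝ)
  have hf : (fun x : EuclideanSpace ℝ (Fin p) × ℝ => (x.2, inner ℝ g' x.1)) = f := by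
    ext x <;> simp [f]
  have hk : (fun x : ℝ × ℝ => (x.1, ρ * x.1 + √(‖g'‖ ^ 2 - ρ ^ 2) * x.2)) = k := by
    ext x <;> simp [k]
  rw [hf, hk, regLaw, Measure.map_map (by fun_prop) (by fun_prop),
    ← ContinuousLinearMap.coe_comp]
  have : IsProbabilityMeasure ((baseLaw p).map (f.comp (regMap g))) :=
    Measure.isProbabilityMeasure_map (by fun_prop)
  have : IsProbabilityMeasure (((gaussianReal 0 1).prod (gaussianReal 0 1)).map k) :=
    Measure.isProbabilityMeasure_map (by fun_prop)
  refine Measure.ext_of_charFunDual (funext fun L => ?_)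
  have hL (a b : ℝ) : L (a, b) = a * L (1, 0) + b * L (0, 1) := by
    have : (a, b) = a • ((1 : ℝ), (0 : ℝ)) + b • ((0 : ℝ), (1 : ℝ)) := by simp
    rw [this, map_add, map_smul, map_smul, smul_eq_mul, smul_eq_mul]
  rw [charFunDual_map, charFunDual_map, charFunDual_gaussianReal_prod, baseLaw,
    charFunDual_gaussian_prod Matrix.PosSemidef.one 1 _ (L (1, 0) • g + L (0, 1) • g')
      (L (1, 0) * √(1 - ‖g‖ ^ 2))]
  · congr 4
    have e1 : (L.comp k) (1, 0) = L (1, 0) + ρ * L (0, 1) := by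
      simp [k, hL 1 ρ]
    have e2 : (L.comp k) (0, 1) = √(‖g'‖ ^ 2 - ρ ^ 2) * L (0, 1) := by
      have h := hL 0 √(‖g'‖ ^ 2 - ρ ^ 2)
      rw [zero_mul, zero_add] at h
      rw [← h]
      simp [k]
    rw [e1, e2, mul_pow, mul_pow, Real.sq_sqrt hv, Real.sq_sqrt hρ, covForm_one, inner_add_left,
      inner_add_right, inner_add_right]
    simp only [real_inner_smul_left, real_inner_smul_right, real_inner_comm g g', ← hρdef,
      NNReal.coe_one]
    rw [real_inner_self_eq_norm_sq, real_inner_self_eq_norm_sq]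
    ring
  · intro x e
    simp [f, hL (_ + _), inner_add_left, real_inner_smul_left]
    ring

/-- The chi-square type affinity of two alternatives. -/
lemma lintegral_likRatio_mul {g g' : EuclideanSpace ℝ (Fin p)} (hg : ‖g‖ < 1) (hg' : ‖g'‖ < 1) :
    ∫⁻ x, ENNReal.ofReal (likRatio g x * likRatio g' x) ∂(baseLaw p) =
      ENNReal.ofReal ((1 - inner ℝ g g')⁻¹) := by
  set ρ : ℝ := inner ℝ g g' with hρdef
  have hmr : Measurable fun x : ℝ × ℝ =>
      ENNReal.ofReal (gaussRatio (1 - ‖g'‖ ^ 2) x.2 x.1) := by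
    unfold gaussRatio; fun_prop
  have h1 : ∫⁻ x, ENNReal.ofReal (likRatio g x * likRatio g' x) ∂(baseLaw p) =
      ∫⁻ x, ENNReal.ofReal (likRatio g' x) ∂(regLaw g) := by
    rw [regLaw_eq_withDensity hg, lintegral_withDensity_eq_lintegral_mul _
      (measurable_likRatio g).ennreal_ofReal (measurable_likRatio g').ennreal_ofReal]
    refine lintegral_congr fun x => ?_
    rw [Pi.mul_apply, ENNReal.ofReal_mul (likRatio_nonneg g x)]
  have h2 : ∫⁻ x, ENNReal.ofReal (likRatio g' x) ∂(regLaw g) =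
      ∫⁻ u, ∫⁻ ζ, ENNReal.ofReal (gaussRatio (1 - ‖g'‖ ^ 2)
        (ρ * u + √(‖g'‖ ^ 2 - ρ ^ 2) * ζ) u) ∂(gaussianReal 0 1) ∂(gaussianReal 0 1) := by
    have e : ∫⁻ x, ENNReal.ofReal (likRatio g' x) ∂(regLaw g) =
        ∫⁻ y, ENNReal.ofReal (gaussRatio (1 - ‖g'‖ ^ 2) y.2 y.1)
          ∂((regLaw g).map (fun x => (x.2, inner ℝ g' x.1))) := by
      rw [lintegral_map hmr (by fun_prop)]
      rfl
    rw [e, map_inner_regLaw hg, lintegral_map hmr (by fun_prop), lintegral_prod]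
    exact (hmr.comp (by fun_prop)).aemeasurable
  have hv : 0 < 1 - ‖g'‖ ^ 2 := by nlinarith [norm_nonneg g']
  have hρ1 : |ρ| < 1 := by
    refine (abs_real_inner_le_norm g g').trans_lt ?_
    nlinarith [norm_nonneg g, norm_nonneg g']
  have hρ : 0 ≤ ‖g'‖ ^ 2 - ρ ^ 2 := by
    have h1 := abs_real_inner_le_norm g g'
    have h2 : |ρ| ≤ ‖g'‖ := h1.trans (mul_le_of_le_one_left (norm_nonneg _) hg.le)
    have h3 : ρ ^ 2 ≤ ‖g'‖ ^ 2 := by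
      rw [← sq_abs]; exact pow_le_pow_left₀ (abs_nonneg _) h2 2
    linarith
  obtain ⟨hρl, hρr⟩ := abs_lt.1 hρ1
  rw [h1, h2]
  set v := 1 - ‖g'‖ ^ 2 with hvdef
  set τ := √(‖g'‖ ^ 2 - ρ ^ 2) with hτdef
  have hτ : τ ^ 2 = 1 - v - ρ ^ 2 := by rw [hτdef, Real.sq_sqrt hρ, hvdef]; ring
  have hvτ : v + τ ^ 2 = (1 - ρ) * (1 + ρ) := by rw [hτ]; ring
  have hτv : 0 < 1 + τ ^ 2 / v := by positivity
  have hp1 : 0 < 1 + ρ := by linarith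
  have hm1 : 0 < 1 - ρ := by linarith
  -- The integral over the independent component.
  have inner_int (u : ℝ) : ∫⁻ ζ, ENNReal.ofReal (gaussRatio v (ρ * u + τ * ζ) u)
      ∂(gaussianReal 0 1) = ENNReal.ofReal ((√v)⁻¹ * (√(1 + τ ^ 2 / v))⁻¹) *
        ENNReal.ofReal (Real.exp (-(-(2 * ρ / (1 + ρ)) / 2) * u ^ 2 + 0 * u)) := by
    have e (ζ : ℝ) : gaussRatio v (ρ * u + τ * ζ) u =
        ((√v)⁻¹ * Real.exp (-((1 - ρ) * u) ^ 2 / (2 * v) + u ^ 2 / 2)) *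
          Real.exp (-(τ ^ 2 / v / 2) * ζ ^ 2 + ((1 - ρ) * u * τ / v) * ζ) := by
      rw [gaussRatio, mul_assoc, ← Real.exp_add]
      congr 2
      field_simp
      ring
    have e0 : 0 ≤ (√v)⁻¹ * Real.exp (-((1 - ρ) * u) ^ 2 / (2 * v) + u ^ 2 / 2) := by positivity
    simp_rw [e, ENNReal.ofReal_mul e0]
    rw [lintegral_const_mul _ (by fun_prop),
      lintegral_exp_quadratic_gaussianReal (by linarith), ← ENNReal.ofReal_mul e0,
      ← ENNReal.ofReal_mul (by positivity)]
    congr 1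
    have e3 : -((1 - ρ) * u) ^ 2 / (2 * v) + u ^ 2 / 2 +
        ((1 - ρ) * u * τ / v) ^ 2 / (2 * (1 + τ ^ 2 / v)) =
        -(-(2 * ρ / (1 + ρ)) / 2) * u ^ 2 + 0 * u := by
      have e4 : 1 + τ ^ 2 / v = (1 - ρ) * (1 + ρ) / v := by rw [← hvτ]; field_simp
      rw [e4, div_pow, mul_pow _ τ, hτ]
      field_simp
      ring
    rw [← e3, Real.exp_add (_ + _)]
    ring
  simp_rw [inner_int]
  have e5 : 1 + -(2 * ρ / (1 + ρ)) = (1 - ρ) / (1 + ρ) := by field_simp; ring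
  rw [lintegral_const_mul _ (by fun_prop),
    lintegral_exp_quadratic_gaussianReal (by
      have : 0 < 1 + -(2 * ρ / (1 + ρ)) := by rw [e5]; positivity
      linarith), ← ENNReal.ofReal_mul (by positivity)]
  congr 1
  have e6 : v * (1 + τ ^ 2 / v) * ((1 - ρ) / (1 + ρ)) = (1 - ρ) ^ 2 := by
    have e7 : v * (1 + τ ^ 2 / v) = (1 - ρ) * (1 + ρ) := by rw [← hvτ]; field_simp
    rw [e7]; field_simp
  simp only [e5, ne_eq, OfNat.ofNat_ne_zero, not_false_eq_true, zero_pow, zero_div, Real.exp_zero,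
    mul_one, ← mul_inv]
  rw [← Real.sqrt_mul hv.le, ← Real.sqrt_mul (by positivity), e6, Real.sqrt_sq hm1.le]

end Alternatives

/-! ### Mixtures of alternatives and the reduction of the lower bound to an affinity bound -/

lemma lintegral_pi_prod {Ω ι : Type*} [MeasurableSpace Ω] [Fintype ι] (μ : Measure Ω)
    [IsProbabilityMeasure μ] {f : ι → Ω → ℝ≥0∞} (hf : ∀ i, Measurable (f i)) :
    ∫⁻ x, ∏ i, f i (x i) ∂(Measure.pi fun _ : ι => μ) = ∏ i, ∫⁻ ω, f i ω ∂μ := by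
  rw [lintegral_prod_eq_prod_lintegral_of_indepFun Finset.univ
    (fun (i : ι) (x : ι → Ω) => f i (x i))
    (iIndepFun_pi (X := fun i ω => f i ω) fun i => (hf i).aemeasurable) fun i => by fun_prop]
  refine Finset.prod_congr rfl fun i _ => ?_
  exact (measurePreserving_eval (fun _ : ι => μ) i).lintegral_comp (hf i)

lemma pi_withDensity {Ω ι : Type*} [MeasurableSpace Ω] [Fintype ι] (μ : Measure Ω)
    [IsProbabilityMeasure μ] {f : Ω → ℝ≥0∞} (hf : Measurable f)
    [IsProbabilityMeasure (μ.withDensity f)] :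
    Measure.pi (fun _ : ι => μ.withDensity f) =
      (Measure.pi fun _ : ι => μ).withDensity fun x => ∏ i, f (x i) := by
  refine Measure.pi_eq fun s hs => ?_
  rw [withDensity_apply _ (MeasurableSet.univ_pi hs),
    ← lintegral_indicator (MeasurableSet.univ_pi hs)]
  have h (x : ι → Ω) : (Set.univ.pi s).indicator (fun x : ι → Ω => ∏ i, f (x i)) x =
      ∏ i, (s i).indicator f (x i) := by
    by_cases hx : x ∈ Set.univ.pi s
    · rw [Set.indicator_of_mem hx]
      exact Finset.prod_congr rfl fun i _ => (Set.indicator_of_mem (hx i trivial) f).symm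
    · rw [Set.indicator_of_notMem hx]
      simp only [Set.mem_pi, Set.mem_univ, true_imp_iff, not_forall] at hx
      obtain ⟨i, hi⟩ := hx
      exact (Finset.prod_eq_zero (Finset.mem_univ i) (Set.indicator_of_notMem hi f)).symm
  simp_rw [h]
  rw [lintegral_pi_prod μ fun i => hf.indicator (hs i)]
  refine Finset.prod_congr rfl fun i _ => ?_
  rw [withDensity_apply _ (hs i), lintegral_indicator (hs i)]

/-- A density with second moment close to one gives almost no additional mass to any event. -/
lemma setIntegral_le_of_sq {Ω : Type*} [MeasurableSpace Ω] {P : Measure Ω} [IsProbabilityMeasure P]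
    {L : Ω → ℝ} (hL : Integrable L P) (hL2 : Integrable (fun x => L x ^ 2) P)
    (h1 : ∫ x, L x ∂P = 1) (h2 : ∫ x, L x ^ 2 ∂P ≤ 17 / 16) (A : Set Ω) :
    ∫ x in A, L x ∂P ≤ P.real A + 1 / 4 := by
  have e (x) : 2 * (L x - 1) ^ 2 + 1 / 8 = 2 * L x ^ 2 - 4 * L x + 17 / 8 := by ring
  have i1 : Integrable (fun x => 2 * (L x - 1) ^ 2 + 1 / 8) P := by
    simp_rw [e]
    exact ((hL2.const_mul 2).sub (hL.const_mul 4)).add (integrable_const _)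
  have i2 : ∫ x, (2 * (L x - 1) ^ 2 + 1 / 8) ∂P ≤ 1 / 4 := by
    simp_rw [e]
    have i0 : Integrable (fun x => 2 * L x ^ 2 - 4 * L x) P :=
      (hL2.const_mul 2).sub (hL.const_mul 4)
    rw [integral_add i0 (integrable_const _),
      integral_sub (hL2.const_mul 2) (hL.const_mul 4), integral_const_mul, integral_const_mul, h1]
    simp
    linarith
  have i3 : ∫ x in A, (L x - 1) ∂P ≤ 1 / 4 := by
    calc ∫ x in A, (L x - 1) ∂P ≤ ∫ x in A, (2 * (L x - 1) ^ 2 + 1 / 8) ∂P := by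
          refine integral_mono (hL.sub (integrable_const _)).integrableOn i1.integrableOn fun x => ?_
          nlinarith [sq_nonneg (4 * (L x - 1) - 1)]
      _ ≤ ∫ x, (2 * (L x - 1) ^ 2 + 1 / 8) ∂P :=
          setIntegral_le_integral i1 (Filter.Eventually.of_forall fun x => by positivity)
      _ ≤ _ := i2
  rw [integral_sub hL.integrableOn (integrable_const _).integrableOn] at i3
  simp at i3
  linarith

section Mixture

variable {p : ℕ}

lemma integral_likRatio_mul {g g' : EuclideanSpace ℝ (Fin p)} (hg : ‖g‖ < 1) (hg' : ‖g'‖ < 1) :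
    Integrable (fun x => likRatio g x * likRatio g' x) (baseLaw p) ∧
      ∫ x, likRatio g x * likRatio g' x ∂(baseLaw p) = (1 - inner ℝ g g')⁻¹ := by
  have hm : Measurable fun x => likRatio g x * likRatio g' x :=
    (measurable_likRatio g).mul (measurable_likRatio g')
  have hnn (x) : 0 ≤ likRatio g x * likRatio g' x :=
    mul_nonneg (likRatio_nonneg g x) (likRatio_nonneg g' x)
  have h := lintegral_likRatio_mul hg hg'
  have hpos : 0 ≤ (1 - inner ℝ g g')⁻¹ := by
    rw [inv_nonneg, sub_nonneg]
    refine (le_abs_self _).trans ((abs_real_inner_le_norm g g').trans ?_)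
    nlinarith [norm_nonneg g, norm_nonneg g']
  constructor
  · refine ⟨hm.aestronglyMeasurable, ?_⟩
    rw [hasFiniteIntegral_iff_ofReal (Filter.Eventually.of_forall hnn), h]
    exact ENNReal.ofReal_lt_top
  · rw [integral_eq_lintegral_of_nonneg_ae (Filter.Eventually.of_forall hnn)
      hm.aestronglyMeasurable, h, ENNReal.toReal_ofReal hpos]

lemma integral_likRatio {g : EuclideanSpace ℝ (Fin p)} (hg : ‖g‖ < 1) :
    Integrable (likRatio g) (baseLaw p) ∧ ∫ x, likRatio g x ∂(baseLaw p) = 1 := by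
  have h := integral_likRatio_mul (g := g) (g' := 0) hg (by simp)
  have e (x) : likRatio (0 : EuclideanSpace ℝ (Fin p)) x = 1 := by
    simp [likRatio, gaussRatio]
    ring
  simpa [e] using h

/-- The average of the laws of `n` observations under finitely many alternatives is close to the
law under the null hypothesis if the average affinity is close to one. -/
lemma average_regLaw_le {n : ℕ} {T : Type*} [Fintype T] [Nonempty T]
    {g : T → EuclideanSpace ℝ (Fin p)} (hg : ∀ t, ‖g t‖ < 1)
    (hsum : ∑ t, ∑ t', ((1 - inner ℝ (g t) (g t'))⁻¹) ^ n ≤ 17 / 16 * (Fintype.card T : ℝ) ^ 2)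
    {A : Set (Fin n → EuclideanSpace ℝ (Fin p) × ℝ)} (hA : MeasurableSet A) :
    (∑ t, (Measure.pi fun _ : Fin n => regLaw (g t)).real A) / Fintype.card T ≤
      (Measure.pi fun _ : Fin n => baseLaw p).real A + 1 / 4 := by
  set P := Measure.pi fun _ : Fin n => baseLaw p
  set N : ℝ := ((Fintype.card T : ℕ) : ℝ) with hNdef
  have hN : 0 < N := by rw [hNdef]; exact_mod_cast Fintype.card_pos
  set F : T → (Fin n → EuclideanSpace ℝ (Fin p) × ℝ) → ℝ := fun t x => ∏ i, likRatio (g t) (x i)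
    with hF
  have hFnn (t x) : 0 ≤ F t x := Finset.prod_nonneg fun i _ => likRatio_nonneg _ _
  have hFi (t) : Integrable (F t) P :=
    Integrable.fintype_prod fun _ => (integral_likRatio (hg t)).1
  have hF1 (t) : ∫ x, F t x ∂P = 1 := by
    rw [hF, integral_fintype_prod_eq_prod (fun _ => likRatio (g t))]
    simp [(integral_likRatio (hg t)).2]
  have hFF (t t') : (fun x => F t x * F t' x) =
      fun x => ∏ i, (likRatio (g t) (x i) * likRatio (g t') (x i)) := by
    ext x; exact Finset.prod_mul_distrib.symm
  have hFFi (t t') : Integrable (fun x => F t x * F t' x) P := by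
    rw [hFF]
    exact Integrable.fintype_prod (f := fun _ x => likRatio (g t) x * likRatio (g t') x)
      fun _ => (integral_likRatio_mul (hg t) (hg t')).1
  have hFF1 (t t') : ∫ x, F t x * F t' x ∂P = ((1 - inner ℝ (g t) (g t'))⁻¹) ^ n := by
    rw [hFF, integral_fintype_prod_eq_prod (fun _ x => likRatio (g t) x * likRatio (g t') x)]
    simp [(integral_likRatio_mul (hg t) (hg t')).2]
  have hreal (t) : (Measure.pi fun _ : Fin n => regLaw (g t)).real A = ∫ x in A, F t x ∂P := by
    have hpr : IsProbabilityMeasure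
        ((baseLaw p).withDensity fun x => ENNReal.ofReal (likRatio (g t) x)) := by
      rw [← regLaw_eq_withDensity (hg t)]; infer_instance
    rw [regLaw_eq_withDensity (hg t), pi_withDensity _ (measurable_likRatio _).ennreal_ofReal,
      measureReal_def, withDensity_apply _ hA,
      integral_eq_lintegral_of_nonneg_ae (Filter.Eventually.of_forall (hFnn t))
        (hFi t).aestronglyMeasurable.restrict]
    congr 1
    refine lintegral_congr fun x => ?_
    rw [hF, ENNReal.ofReal_prod_of_nonneg fun i _ => likRatio_nonneg _ _]
  set L : (Fin n → EuclideanSpace ℝ (Fin p) × ℝ) → ℝ := fun x => (∑ t, F t x) / N with hLdef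
  have hLi : Integrable L P := (integrable_finsetSum _ fun t _ => hFi t).div_const N
  have hLsq (x) : L x ^ 2 = (∑ t, ∑ t', F t x * F t' x) / N ^ 2 := by
    rw [hLdef, div_pow, sq (∑ t, F t x), Finset.sum_mul_sum]
  have hL1 : ∫ x, L x ∂P = 1 := by
    rw [hLdef, integral_div, integral_finsetSum _ fun t _ => hFi t]
    simp only [hF1, Finset.sum_const, Finset.card_univ, nsmul_eq_mul, mul_one]
    exact div_self hN.ne'
  have hLi2 : Integrable (fun x => L x ^ 2) P := by
    simp_rw [hLsq]
    exact (integrable_finsetSum _ fun t _ =>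
      integrable_finsetSum _ fun t' _ => hFFi t t').div_const _
  have hL2 : ∫ x, L x ^ 2 ∂P ≤ 17 / 16 := by
    simp_rw [hLsq]
    rw [integral_div, integral_finsetSum _ fun t _ => integrable_finsetSum _ fun t' _ => hFFi t t',
      div_le_iff₀ (by positivity)]
    refine le_of_eq_of_le (Finset.sum_congr rfl fun t _ => ?_) hsum
    rw [integral_finsetSum _ fun t' _ => hFFi t t']
    exact Finset.sum_congr rfl fun t' _ => hFF1 t t'
  have key := setIntegral_le_of_sq hLi hLi2 hL1 hL2 A
  rw [hLdef, integral_div, integral_finsetSum _ fun t _ => (hFi t).integrableOn] at key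
  simp_rw [hreal]
  exact key

/-- Intervals that are valid at a null parameter and at alternatives whose mixture cannot be
distinguished from it are, at the null parameter, as long as the separation in the first
coefficient, up to a constant factor. -/
lemma le_minimaxLength [NeZero p] {n : ℕ} {α : ℝ} (hα1 : α < 1 / 4)
    {Θ₀ Θ₁ : Set (Param p)} {T : Type*} [Fintype T] [Nonempty T]
    {g : T → EuclideanSpace ℝ (Fin p)} (hg : ∀ t, ‖g t‖ < 1)
    (hsum : ∑ t, ∑ t', ((1 - inner ℝ (g t) (g t'))⁻¹) ^ n ≤ 17 / 16 * (Fintype.card T : ℝ) ^ 2)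
    {φ : EuclideanSpace ℝ (Fin p) × ℝ → ℝ × EuclideanSpace ℝ (Fin p)} (hφ : Measurable φ)
    {θ₀ : Param p} {θ : T → Param p} {δ : ℝ} (h₀ : θ₀ ∈ Θ₀) (h₁ : θ₀ ∈ Θ₁) (hθ : ∀ t, θ t ∈ Θ₀)
    (hlaw₀ : θ₀.obsLaw = (baseLaw p).map φ) (hlaw : ∀ t, (θ t).obsLaw = (regLaw (g t)).map φ)
    (hδ : ∀ t, (θ t).beta = θ₀.beta + δ) :
    ENNReal.ofReal (|δ| / 4) ≤ minimaxLength n α Θ₀ Θ₁ := by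
  refine le_iInf₂ fun I hI => ?_
  refine le_trans ?_ (le_iSup₂ (f := fun θ (_ : θ ∈ Θ₁) =>
    ∫⁻ D, Metric.ediam (Set.Icc (I.1 D) (I.2 D)) ∂(θ.law n)) θ₀ h₁)
  obtain ⟨hm1, hm2, hcov⟩ := hI
  set Φ : (Fin n → EuclideanSpace ℝ (Fin p) × ℝ) → Data n p := fun x i => φ (x i)
  have hΦ : Measurable Φ := by fun_prop
  have hpi (μ : Measure (EuclideanSpace ℝ (Fin p) × ℝ)) [IsProbabilityMeasure μ] :
      Measure.pi (fun _ : Fin n => μ.map φ) = (Measure.pi fun _ : Fin n => μ).map Φ := by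
    have : IsProbabilityMeasure (μ.map φ) := Measure.isProbabilityMeasure_map hφ.aemeasurable
    exact (Measure.pi_map_pi (μ := fun _ : Fin n => μ) (f := fun _ => φ)
      fun _ => hφ.aemeasurable).symm
  have hcovR {ϑ : Param p} (hϑ : ϑ ∈ Θ₀) :
      1 - α ≤ (ϑ.law n).real {D | I.1 D ≤ ϑ.beta ∧ ϑ.beta ≤ I.2 D} := by
    have := hcov ϑ hϑ
    rwa [← ofReal_measureReal, ENNReal.ofReal_le_ofReal_iff measureReal_nonneg] at this
  have hmeas (b : ℝ) : MeasurableSet {D | I.1 D ≤ b ∧ b ≤ I.2 D} :=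
    (measurableSet_le hm1 measurable_const).inter (measurableSet_le measurable_const hm2)
  set A₀ := {D | I.1 D ≤ θ₀.beta ∧ θ₀.beta ≤ I.2 D}
  set A₁ := {D | I.1 D ≤ θ₀.beta + δ ∧ θ₀.beta + δ ≤ I.2 D}
  have hA₀ : 1 - α ≤ (θ₀.law n).real A₀ := hcovR h₀
  have hA₁ : 1 - α - 1 / 4 ≤ (θ₀.law n).real A₁ := by
    have h := average_regLaw_le (n := n) hg hsum (hΦ (hmeas (θ₀.beta + δ)))
    have hN : (0 : ℝ) < Fintype.card T := by exact_mod_cast Fintype.card_pos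
    have h2 : 1 - α ≤ (∑ t, (Measure.pi fun _ : Fin n => regLaw (g t)).real (Φ ⁻¹' A₁)) /
        Fintype.card T := by
      rw [le_div_iff₀ hN]
      calc (1 - α) * Fintype.card T = ∑ _t : T, (1 - α) := by simp; ring
        _ ≤ _ := Finset.sum_le_sum fun t _ => by
          have := hcovR (hθ t)
          rw [hδ t, Param.law, hlaw t, hpi, map_measureReal_apply hΦ (hmeas _)] at this
          exact this
    rw [Param.law, hlaw₀, hpi, map_measureReal_apply hΦ (hmeas _)]
    have h3 := h2.trans h
    linarith
  have hboth : 1 / 4 ≤ (θ₀.law n).real (A₀ ∩ A₁) := by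
    have h1 := measureReal_union_add_inter (μ := θ₀.law n) (s := A₀) (t := A₁) (hmeas _)
    have h2 : (θ₀.law n).real (A₀ ∪ A₁) ≤ 1 := measureReal_le_one
    linarith
  calc ENNReal.ofReal (|δ| / 4)
      ≤ ENNReal.ofReal |δ| * ENNReal.ofReal ((θ₀.law n).real (A₀ ∩ A₁)) := by
        rw [← ENNReal.ofReal_mul (abs_nonneg _)]
        exact ENNReal.ofReal_le_ofReal (by nlinarith [abs_nonneg δ])
    _ = ∫⁻ _D in A₀ ∩ A₁, ENNReal.ofReal |δ| ∂(θ₀.law n) := by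
        rw [setLIntegral_const, ofReal_measureReal]
    _ ≤ ∫⁻ D in A₀ ∩ A₁, Metric.ediam (Set.Icc (I.1 D) (I.2 D)) ∂(θ₀.law n) := by
        refine setLIntegral_mono' ((hmeas _).inter (hmeas _)) fun D hD => ?_
        have h := Metric.edist_le_ediam_of_mem (s := Set.Icc (I.1 D) (I.2 D)) hD.2 hD.1
        rwa [edist_dist, Real.dist_eq, add_sub_cancel_left] at h
    _ ≤ _ := setLIntegral_le_lintegral _ _

end Mixture

/-! ### The least favourable parameters -/

lemma regLaw_zero {p : ℕ} : regLaw (0 : EuclideanSpace ℝ (Fin p)) = baseLaw p := by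
  have h : ⇑(regMap (0 : EuclideanSpace ℝ (Fin p))) = id := by
    ext x <;> simp
  rw [regLaw, h, Measure.map_id]

/-- A linear image of `regLaw g` is the law of an observation if the variances of all linear forms
agree. -/
lemma obsLaw_eq_map_regLaw {p : ℕ} {θ : Param p} (hS : θ.cov.PosSemidef) (g : EuclideanSpace ℝ (Fin p))
    (φ : (EuclideanSpace ℝ (Fin p) × ℝ) →L[ℝ] (ℝ × EuclideanSpace ℝ (Fin p)))
    (h : ∀ c z, ∃ (w : EuclideanSpace ℝ (Fin p)) (d : ℝ),
      (∀ x e, linForm c z (φ (regMap g (x, e))) = inner ℝ w x + d * e) ∧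
        θ.cross c z c z = ‖w‖ ^ 2 + d ^ 2) :
    θ.obsLaw = (regLaw g).map φ := by
  rw [regLaw, Measure.map_map (by fun_prop) (by fun_prop), ← ContinuousLinearMap.coe_comp]
  have : IsProbabilityMeasure ((baseLaw p).map (φ.comp (regMap g))) :=
    Measure.isProbabilityMeasure_map (by fun_prop)
  refine Measure.ext_of_charFunDual (funext fun L => ?_)
  obtain ⟨c, z, rfl⟩ := exists_eq_linForm L
  obtain ⟨w, d, h1, h2⟩ := h c z
  rw [charFunDual_obsLaw hS, charFunDual_map, baseLaw,
    charFunDual_gaussian_prod Matrix.PosSemidef.one 1 _ w d h1, h2, covForm_one,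
    real_inner_self_eq_norm_sq, NNReal.coe_one, one_mul]

section Spike

variable {p : ℕ} [NeZero p]

/-- The matrix with unit diagonal whose first row and column carry the vector `b`, the identity
elsewhere. -/
def spikeCov (b : EuclideanSpace ℝ (Fin p)) : Matrix (Fin p) (Fin p) ℝ :=
  Matrix.of fun i j => (if i = j then 1 else 0) + (if i = 0 then b j else 0) +
    (if j = 0 then b i else 0)

lemma spikeCov_zero : spikeCov (0 : EuclideanSpace ℝ (Fin p)) = 1 := by
  ext i j; simp [spikeCov, Matrix.one_apply]

variable {b : EuclideanSpace ℝ (Fin p)}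

lemma isHermitian_spikeCov : (spikeCov b).IsHermitian := by
  ext i j
  simp only [spikeCov, Matrix.conjTranspose_apply, Matrix.of_apply, star_trivial, eq_comm (a := j)]
  ring

lemma spikeCov_block (i j : Fin p) (hi : i ≠ 0) (hj : j ≠ 0) :
    spikeCov b i j = if i = j then 1 else 0 := by simp [spikeCov, hi, hj]

lemma covForm_spikeCov (hb0 : b 0 = 0) (x y : EuclideanSpace ℝ (Fin p)) :
    covForm (spikeCov b) x y = x 0 * inner ℝ b y + y 0 * inner ℝ b x + inner ℝ x y := by
  rw [covForm_block hb0 (fun j hj => ?_) spikeCov_block]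
  · simp [spikeCov, hb0]
  · simp [spikeCov, hj, Ne.symm hj]

lemma covForm_spikeCov_bounds (hb0 : b 0 = 0) {ε : ℝ} (hb : 2 * ‖b‖ ≤ ε)
    (x : EuclideanSpace ℝ (Fin p)) :
    (1 - ε) * ‖x‖ ^ 2 ≤ covForm (spikeCov b) x x ∧
      covForm (spikeCov b) x x ≤ (1 + ε) * ‖x‖ ^ 2 := by
  have h : |2 * (x 0 * inner ℝ b x)| ≤ ε * ‖x‖ ^ 2 := by
    have h1 : |x 0| ≤ ‖x‖ := PiLp.norm_apply_le x 0
    have h2 := abs_real_inner_le_norm b x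
    rw [abs_mul, abs_mul, abs_two]
    calc 2 * (|x 0| * |inner ℝ b x|) ≤ 2 * (‖x‖ * (‖b‖ * ‖x‖)) := by gcongr
      _ = 2 * ‖b‖ * ‖x‖ ^ 2 := by ring
      _ ≤ _ := by gcongr
  rw [covForm_spikeCov hb0, real_inner_self_eq_norm_sq]
  rw [abs_le] at h
  constructor <;> linarith

lemma posSemidef_spikeCov (hb0 : b 0 = 0) (hb : 2 * ‖b‖ ≤ 1) : (spikeCov b).PosSemidef :=
  posSemidef_of_eigenvalues isHermitian_spikeCov le_rfl fun i =>
    (eigenvalues_bounds isHermitian_spikeCov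
      (fun x => by simpa using covForm_spikeCov_bounds hb0 hb x) i).1

lemma mem_sparseSpace_spikeCov (hb0 : b 0 = 0) {M M₁ M₂ : ℝ} (hM : 1 < M)
    (hb : 2 * ‖b‖ ≤ 1 - M⁻¹) {s : ℕ} {T : Finset (Fin p)} (hT : ∀ j ∉ T, b j = 0)
    (hTs : T.card + 1 ≤ s) {coef : EuclideanSpace ℝ (Fin p)} {σ : ℝ} (hσ : 0 ≤ σ) (hσ1 : σ ≤ M₁)
    (hc : ‖coef‖ ≤ M₂) : (⟨coef, spikeCov b, σ⟩ : Param p) ∈ sparseSpace p M M₁ M₂ s := by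
  have hM0 : 0 < M := by linarith
  have hMM : 2 - M⁻¹ ≤ M := by
    have : M * M⁻¹ = 1 := mul_inv_cancel₀ hM0.ne'
    nlinarith [inv_pos.2 hM0, sq_nonneg (M - 1)]
  have hbd (x : EuclideanSpace ℝ (Fin p)) : M⁻¹ * ‖x‖ ^ 2 ≤ covForm (spikeCov b) x x ∧
      covForm (spikeCov b) x x ≤ M * ‖x‖ ^ 2 := by
    obtain ⟨h1, h2⟩ := covForm_spikeCov_bounds hb0 hb x
    refine ⟨by simpa using h1, h2.trans ?_⟩
    gcongr
    linarith
  refine ⟨⟨⟨isHermitian_spikeCov, eigenvalues_bounds _ hbd⟩, spikeCov_block, hσ, hσ1, hc⟩, ?_⟩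
  refine le_trans ?_ ((Finset.card_insert_le 0 T).trans hTs)
  rw [Param.rowSparsity, ← Set.ncard_coe_finset]
  refine Set.ncard_le_ncard (fun j hj => ?_) (Set.toFinite _)
  simp only [Finset.coe_insert, Set.mem_insert_iff, Finset.mem_coe]
  by_contra hcon
  simp only [not_or] at hcon
  obtain ⟨-, h2⟩ := inv_apply_zero_of_block
    (isUnit_det_of_covForm (inv_pos.2 hM0) fun x => (hbd x).1) spikeCov_block j hcon.1
  refine hj (h2.trans ?_)
  simp [spikeCov, hT j hcon.2, hcon.1, Ne.symm hcon.1]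

/-- The parameter with uncorrelated covariates, for which the response with coefficients `h g` has
variance `h²`. -/
noncomputable def linParam (h : ℝ) (g : EuclideanSpace ℝ (Fin p)) : Param p :=
  ⟨h • g, spikeCov 0, h * √(1 - ‖g‖ ^ 2)⟩

/-- The map `(X, u) ↦ (h u, X)`. -/
noncomputable def linObs (h : ℝ) :
    (EuclideanSpace ℝ (Fin p) × ℝ) →L[ℝ] (ℝ × EuclideanSpace ℝ (Fin p)) :=
  (h • ContinuousLinearMap.snd ℝ _ ℝ).prod (ContinuousLinearMap.fst ℝ _ ℝ)

lemma obsLaw_linParam (h : ℝ) {g : EuclideanSpace ℝ (Fin p)} (hg : ‖g‖ ≤ 1) :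
    (linParam h g).obsLaw = (regLaw g).map (linObs h) := by
  have hv : 0 ≤ 1 - ‖g‖ ^ 2 := by nlinarith [norm_nonneg g]
  refine obsLaw_eq_map_regLaw (posSemidef_spikeCov (by simp) (by simp)) g _ fun c z =>
    ⟨z + (c * h) • g, c * h * √(1 - ‖g‖ ^ 2), fun x e => ?_, ?_⟩
  · simp [linObs, inner_add_left, real_inner_smul_left]
    ring
  · simp only [linParam, Param.cross, spikeCov_zero, covForm_one, real_inner_self_eq_norm_sq,
      mul_pow, smul_smul]
    ring

/-- The parameter for which the first covariate has regression coefficients `b` on the others,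
while the first covariate and the response divided by `h` are exchangeable and uncorrelated. -/
noncomputable def spikeParam (h : ℝ) (b : EuclideanSpace ℝ (Fin p)) : Param p :=
  ⟨(h / (1 - ‖b‖ ^ 2)) • (b - ‖b‖ ^ 2 • EuclideanSpace.single 0 1), spikeCov b,
    h * √((1 - 2 * ‖b‖ ^ 2) / (1 - ‖b‖ ^ 2))⟩

/-- The map which rotates the pair `(u, X₀)` to the pair of response divided by `h` and first
covariate, and keeps the other coordinates of `X`. -/
noncomputable def spikeObs (h : ℝ) :
    (EuclideanSpace ℝ (Fin p) × ℝ) →L[ℝ] (ℝ × EuclideanSpace ℝ (Fin p)) :=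
  ((h * √(1 / 2)) • (ContinuousLinearMap.snd ℝ _ ℝ +
      (EuclideanSpace.proj (0 : Fin p)).comp (ContinuousLinearMap.fst ℝ _ ℝ))).prod
    (ContinuousLinearMap.fst ℝ _ ℝ +
      (√(1 / 2) • (ContinuousLinearMap.snd ℝ _ ℝ -
          (EuclideanSpace.proj (0 : Fin p)).comp (ContinuousLinearMap.fst ℝ _ ℝ)) -
        (EuclideanSpace.proj (0 : Fin p)).comp (ContinuousLinearMap.fst ℝ _ ℝ)).smulRight
          (EuclideanSpace.single (0 : Fin p) (1 : ℝ)))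

/-- In the rotated coordinates the spike alternatives are regressions of a single variable. -/
lemma obsLaw_spikeParam (h : ℝ) (hb0 : b 0 = 0) (hb : 2 * ‖b‖ ≤ 1) :
    (spikeParam h b).obsLaw = (regLaw ((2 * √(1 / 2)) • b)).map (spikeObs h) := by
  set k := √(1 / 2 : ℝ) with hk
  have hk2 : k ^ 2 = 1 / 2 := Real.sq_sqrt (by norm_num)
  have hk' : (√2)⁻¹ = k := by rw [hk]; simp
  set g := (2 * k) • b with hg
  have hx : ‖b‖ ^ 2 ≤ 1 / 4 := by nlinarith [norm_nonneg b]
  have hgn : ‖g‖ ^ 2 = 2 * ‖b‖ ^ 2 := by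
    rw [hg, norm_smul, mul_pow, Real.norm_eq_abs, sq_abs, mul_pow, hk2]; ring
  refine obsLaw_eq_map_regLaw (θ := spikeParam h b) (posSemidef_spikeCov hb0 hb) g _ fun c z =>
    ⟨(k * (c * h + z 0)) • g + (k * (c * h - z 0) - z 0) • EuclideanSpace.single 0 1 + z,
      k * (c * h + z 0) * √(1 - ‖g‖ ^ 2), fun x e => ?_, ?_⟩
  · simp [spikeObs, hk', inner_add_left, inner_add_right, real_inner_smul_left, real_inner_smul_right,
      EuclideanSpace.inner_single_left, inner_single_zero]
    ring
  · have e1 : 1 - ‖b‖ ^ 2 ≠ 0 := by nlinarith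
    rw [mul_pow _ √(1 - ‖g‖ ^ 2), Real.sq_sqrt (by rw [hgn]; linarith), ← real_inner_self_eq_norm_sq
      (_ + _ + z), hgn]
    simp only [Param.cross, spikeParam, covForm_spikeCov hb0, mul_pow,
      Real.sq_sqrt (show 0 ≤ (1 - 2 * ‖b‖ ^ 2) / (1 - ‖b‖ ^ 2) from
        div_nonneg (by linarith) (by linarith))]
    simp only [hg, inner_add_left, inner_add_right, inner_sub_left, inner_sub_right,
      real_inner_smul_left, real_inner_smul_right, inner_single_zero,
      EuclideanSpace.inner_single_left, real_inner_self_eq_norm_sq, PiLp.add_apply,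
      PiLp.sub_apply, PiLp.smul_apply, PiLp.single_apply, hb0, real_inner_comm b z,
      smul_eq_mul, map_one]
    simp only [if_true, norm_smul, PiLp.norm_single, norm_one, mul_pow, Real.norm_eq_abs, sq_abs,
      norm_sub_sq_real, real_inner_smul_right, inner_single_zero, hb0]
    generalize inner ℝ b z = β
    generalize z 0 = z₀
    generalize ‖b‖ ^ 2 = x at *
    trans c ^ 2 * h ^ 2 + ‖z‖ ^ 2 + 2 * (c * h + z₀) * β
    · field_simp
      ring
    · linear_combination (-(4 * (c * h + z₀) ^ 2 * x * (k ^ 2 + 1 / 2) + 4 * (c * h + z₀) * β +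
        (c * h - z₀) ^ 2 + (c * h + z₀) ^ 2 * (1 - 2 * x))) * hk2

end Spike

/-! ### The lower bounds -/

lemma inv_one_sub_pow_le {x : ℝ} (hx0 : 0 ≤ x) (hx : x ≤ 1 / 2) (n : ℕ) :
    ((1 - x)⁻¹) ^ n ≤ Real.exp (2 * n * x) := by
  have h1 : (1 - x)⁻¹ ≤ Real.exp (2 * x) := by
    rw [inv_le_comm₀ (by linarith) (Real.exp_pos _), ← Real.exp_neg]
    have h2 := Real.add_one_le_exp (2 * x)
    rw [Real.exp_neg, inv_le_comm₀ (Real.exp_pos _) (by linarith)]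
    refine le_trans ?_ h2
    rw [inv_le_comm₀ (by linarith) (by linarith), inv_le_iff_one_le_mul₀ (by linarith)]
    nlinarith
  calc ((1 - x)⁻¹) ^ n ≤ Real.exp (2 * x) ^ n :=
        pow_le_pow_left₀ (inv_nonneg.2 (by linarith)) h1 n
    _ = _ := by rw [← Real.exp_nat_mul]; congr 1; ring

lemma exp_le_of_le_inv_twenty {x : ℝ} (hx : x ≤ 1 / 20) : Real.exp x ≤ 17 / 16 := by
  have h := Real.exp_bound_div_one_sub_of_interval (x := 1 / 20) (by norm_num) (by norm_num)
  refine (Real.exp_le_exp.2 hx).trans (h.trans ?_)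
  norm_num

/-- The parametric part of the lower bound. -/
lemma parametric_le_minimaxLength {M M₁ M₂ α h : ℝ} (hM : 1 < M) (hα1 : α < 1 / 4) (hh : 0 < h)
    (h1 : h ≤ M₁) (h2 : h ≤ M₂) {n p s s₁ : ℕ} [NeZero p] (hn : 0 < n) (hs : 1 ≤ s)
    (hs₁ : 1 ≤ s₁) :
    ENNReal.ofReal (h / 28 * (1 / √n)) ≤
      minimaxLength n α (sparseSpace p M M₁ M₂ s) (sparseSpace p M M₁ M₂ s₁) := by
  have hn0 : (1 : ℝ) ≤ n := by exact_mod_cast hn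
  set a : ℝ := 1 / (7 * √n) with ha
  have ha0 : 0 ≤ a := by positivity
  have ha2 : a ^ 2 = 1 / (49 * n) := by
    rw [ha, div_pow, mul_pow, Real.sq_sqrt (by positivity)]; norm_num
  have ha2' : a ^ 2 ≤ 1 / 49 := by
    rw [ha2]; exact one_div_le_one_div_of_le (by norm_num) (by linarith)
  have ha1 : a < 1 := by nlinarith
  set g : EuclideanSpace ℝ (Fin p) := EuclideanSpace.single 0 a with hg
  have hgn : ‖g‖ = a := by rw [hg, PiLp.norm_single, Real.norm_eq_abs, abs_of_nonneg ha0]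
  have hmem (g' : EuclideanSpace ℝ (Fin p)) (hg' : ‖g'‖ ≤ 1) (s : ℕ) (hs : 1 ≤ s) :
      linParam h g' ∈ sparseSpace p M M₁ M₂ s := by
    refine mem_sparseSpace_spikeCov (T := ∅) (by simp) hM ?_ (by simp) (by simpa using hs)
      (by positivity) ?_ ?_
    · rw [norm_zero, mul_zero, sub_nonneg]
      exact inv_le_one_of_one_le₀ hM.le
    · refine le_trans (mul_le_of_le_one_right hh.le ?_) h1
      rw [Real.sqrt_le_left zero_le_one, one_pow]
      nlinarith [norm_nonneg g']
    · rw [norm_smul, Real.norm_eq_abs, abs_of_pos hh]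
      exact (mul_le_of_le_one_right hh.le hg').trans h2
  have key := le_minimaxLength (n := n) (α := α) hα1 (Θ₀ := sparseSpace p M M₁ M₂ s)
    (Θ₁ := sparseSpace p M M₁ M₂ s₁) (T := Unit) (g := fun _ => g) (by simpa [hgn] using ha1)
    ?_ (φ := linObs h) (by fun_prop) (θ₀ := linParam h 0) (θ := fun _ => linParam h g)
    (δ := h * a) (hmem 0 (by simp) s hs) (hmem 0 (by simp) s₁ hs₁)
    (fun _ => hmem g (by rw [hgn]; exact ha1.le) s hs)
    (by rw [obsLaw_linParam h (by simp), regLaw_zero])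
    (fun _ => obsLaw_linParam h (by rw [hgn]; exact ha1.le))
    (fun _ => by simp [linParam, Param.beta, hg])
  · refine le_trans (ENNReal.ofReal_le_ofReal (le_of_eq ?_)) key
    rw [abs_of_nonneg (by positivity), ha]
    field_simp
    norm_num
  · simp only [Finset.univ_unique, Finset.sum_singleton, Fintype.card_unique, Nat.cast_one,
      one_pow, mul_one, real_inner_self_eq_norm_sq, hgn]
    refine (inv_one_sub_pow_le (sq_nonneg a) (by linarith) n).trans (exp_le_of_le_inv_twenty ?_)
    rw [ha2]
    field_simp
    norm_num

section Blocks

variable {p k B : ℕ}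

/-- The vector with the entry `r` at one position of each of `k` blocks of `B` coordinates; the
blocks are described by an injection `e`. Choosing one position per block makes the overlap of two
random supports a sum of independent indicators. -/
noncomputable def blockVec (e : Fin k × Fin B → Fin p) (r : ℝ) (t : Fin k → Fin B) :
    EuclideanSpace ℝ (Fin p) :=
  ∑ i, EuclideanSpace.single (e (i, t i)) r

variable {e : Fin k × Fin B → Fin p}

lemma inner_blockVec (he : Function.Injective e) (r : ℝ) (t t' : Fin k → Fin B) :
    inner ℝ (blockVec e r t) (blockVec e r t') = ∑ i, if t i = t' i then r ^ 2 else 0 := by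
  rw [blockVec, blockVec, sum_inner]
  refine Finset.sum_congr rfl fun i _ => ?_
  rw [inner_sum, Finset.sum_eq_single i]
  · rw [EuclideanSpace.inner_single_left, PiLp.single_apply]
    simp only [conj_trivial, he.eq_iff, Prod.mk.injEq, true_and, mul_ite, mul_zero, sq]
  · intro j _ hj
    rw [EuclideanSpace.inner_single_left, PiLp.single_apply, if_neg, mul_zero]
    intro h
    exact hj (Prod.mk.inj (he h)).1.symm
  · simp

lemma norm_sq_blockVec (he : Function.Injective e) (r : ℝ) (t : Fin k → Fin B) : ‖blockVec e r t‖ ^ 2 = k * r ^ 2 := by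
  rw [← real_inner_self_eq_norm_sq, inner_blockVec he]
  simp

/-- The affinities of the block alternatives, summed over all pairs. -/
lemma sum_affinity_blockVec_le [NeZero B] (he : Function.Injective e) (r : ℝ) {n : ℕ} (hr : k * r ^ 2 ≤ 1 / 4)
    (hB : k * (Real.exp (4 * n * r ^ 2) - 1) / B ≤ 1 / 20) :
    ∑ t : Fin k → Fin B, ∑ t' : Fin k → Fin B,
      ((1 - 2 * inner ℝ (blockVec e r t) (blockVec e r t'))⁻¹) ^ n ≤
        17 / 16 * (Fintype.card (Fin k → Fin B) : ℝ) ^ 2 := by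
  set E := Real.exp (4 * n * r ^ 2)
  have hB0 : (0 : ℝ) < B := by exact_mod_cast Nat.pos_of_ne_zero (NeZero.ne B)
  have hE : 1 ≤ E := Real.one_le_exp (by positivity)
  have hterm (t t' : Fin k → Fin B) :
      ((1 - 2 * inner ℝ (blockVec e r t) (blockVec e r t'))⁻¹) ^ n ≤
        ∏ i, if t i = t' i then E else 1 := by
    rw [inner_blockVec he]
    have h0 : 0 ≤ ∑ i, if t i = t' i then r ^ 2 else 0 :=
      Finset.sum_nonneg fun i _ => by split_ifs <;> positivity
    have h1 : (∑ i, if t i = t' i then r ^ 2 else 0) ≤ k * r ^ 2 := by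
      calc _ ≤ ∑ _i : Fin k, r ^ 2 :=
            Finset.sum_le_sum fun i _ => by split_ifs <;> [exact le_rfl; positivity]
        _ = _ := by simp
    refine (inv_one_sub_pow_le (by linarith) (by linarith) n).trans (le_of_eq ?_)
    rw [Finset.mul_sum, Finset.mul_sum, Real.exp_sum]
    refine Finset.prod_congr rfl fun i _ => ?_
    split_ifs
    · simp only [E]; congr 1; ring
    · simp
  have hsum (t : Fin k → Fin B) :
      ∑ t' : Fin k → Fin B, ∏ i, (if t i = t' i then E else 1) = (B + (E - 1)) ^ k := by
    rw [← Fintype.prod_sum (fun i (b : Fin B) => if t i = b then E else 1)]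
    have h (i : Fin k) : ∑ b : Fin B, (if t i = b then E else 1) = B + (E - 1) := by
      have h2 (b : Fin B) : (if t i = b then E else 1) = 1 + if t i = b then E - 1 else 0 := by
        split_ifs <;> ring
      simp_rw [h2, Finset.sum_add_distrib]
      simp
    simp [h]
  calc _ ≤ ∑ t : Fin k → Fin B, ∑ t' : Fin k → Fin B, ∏ i, (if t i = t' i then E else 1) :=
        Finset.sum_le_sum fun t _ => Finset.sum_le_sum fun t' _ => hterm t t'
    _ = (B : ℝ) ^ k * (B + (E - 1)) ^ k := by simp [hsum]
    _ = ((B : ℝ) ^ k) ^ 2 * ((E - 1) / B + 1) ^ k := by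
        have : (B : ℝ) + (E - 1) = B * ((E - 1) / B + 1) := by field_simp; ring
        rw [this, mul_pow]; ring
    _ ≤ ((B : ℝ) ^ k) ^ 2 * (17 / 16) := by
        gcongr
        have h0 : 0 ≤ (E - 1) / B := div_nonneg (by linarith) hB0.le
        calc ((E - 1) / B + 1) ^ k ≤ Real.exp ((E - 1) / B) ^ k := by
              gcongr; exact Real.add_one_le_exp _
          _ = Real.exp (k * (E - 1) / B) := by rw [← Real.exp_nat_mul]; congr 1; ring
          _ ≤ _ := exp_le_of_le_inv_twenty hB
    _ = _ := by simp [mul_comm]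

/-- The sparse part of the lower bound, for given block sizes. -/
lemma spike_le_minimaxLength [NeZero p] [NeZero B] (he : Function.Injective e) (r : ℝ)
    (he0 : ∀ x, e x ≠ 0) {M M₁ M₂ α h : ℝ} (hM : 1 < M)
    (hα1 : α < 1 / 4) (hh : 0 < h)
    (h1 : h ≤ M₁) (h2 : h ≤ M₂) {n s s₁ : ℕ} (hs : k + 1 ≤ s) (hs₁ : 1 ≤ s₁)
    (hr : 4 * (k * r ^ 2) ≤ (1 - M⁻¹) ^ 2)
    (hB : k * (Real.exp (4 * n * r ^ 2) - 1) / B ≤ 1 / 20) :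
    ENNReal.ofReal (h * (k * r ^ 2) / 4) ≤
      minimaxLength n α (sparseSpace p M M₁ M₂ s) (sparseSpace p M M₁ M₂ s₁) := by
  have hMi : M⁻¹ ≤ 1 := inv_le_one_of_one_le₀ hM.le
  have hMp : 0 < M⁻¹ := inv_pos.2 (by linarith)
  have hx : k * r ^ 2 ≤ 1 / 4 := by nlinarith
  set x : ℝ := k * r ^ 2 with hxdef
  have hx0 : 0 ≤ x := by positivity
  set b := blockVec e r with hb
  have hbn (t) : ‖b t‖ ^ 2 = x := norm_sq_blockVec he r t
  have hb0 (t) : b t 0 = 0 := by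
    rw [hb, blockVec, WithLp.ofLp_sum, Finset.sum_apply]
    exact Finset.sum_eq_zero fun i _ => by simp [(he0 _).symm]
  have hb2 (t) : 2 * ‖b t‖ ≤ 1 - M⁻¹ := by
    refine le_of_sq_le_sq ?_ (by linarith)
    rw [mul_pow, hbn]; linarith
  have hbsupp (t : Fin k → Fin B) (j : Fin p) (hj : j ∉ Finset.univ.image fun i => e (i, t i)) :
      b t j = 0 := by
    rw [hb, blockVec, WithLp.ofLp_sum, Finset.sum_apply]
    refine Finset.sum_eq_zero fun i _ => ?_
    have : j ≠ e (i, t i) := fun h => hj (Finset.mem_image.2 ⟨i, Finset.mem_univ _, h.symm⟩)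
    simp [this]
  have hmem (b : EuclideanSpace ℝ (Fin p)) (hb0 : b 0 = 0) (hb2 : 2 * ‖b‖ ≤ 1 - M⁻¹)
      {s : ℕ} {T : Finset (Fin p)} (hT : ∀ j ∉ T, b j = 0) (hTs : T.card + 1 ≤ s) :
      spikeParam h b ∈ sparseSpace p M M₁ M₂ s := by
    have hb4 : ‖b‖ ^ 2 ≤ 1 / 4 := by nlinarith [norm_nonneg b]
    refine mem_sparseSpace_spikeCov hb0 hM hb2 hT hTs (by positivity) ?_ ?_
    · refine le_trans (mul_le_of_le_one_right hh.le ?_) h1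
      rw [Real.sqrt_le_left zero_le_one, one_pow, div_le_one (by linarith)]
      nlinarith [sq_nonneg ‖b‖]
    · refine le_trans ?_ h2
      refine le_of_sq_le_sq ?_ hh.le
      rw [norm_smul, mul_pow, norm_sub_sq_real, real_inner_smul_right, inner_single_zero, hb0,
        norm_smul, PiLp.norm_single, Real.norm_eq_abs, sq_abs, norm_one, mul_one,
        Real.norm_eq_abs, sq_abs, div_pow]
      have h3 : 0 < 1 - ‖b‖ ^ 2 := by linarith
      rw [div_mul_eq_mul_div, div_le_iff₀ (by positivity)]
      have h4 : ‖b‖ ^ 2 - 2 * (‖b‖ ^ 2 * 0) + (‖b‖ ^ 2) ^ 2 ≤ (1 - ‖b‖ ^ 2) ^ 2 := by nlinarith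
      exact mul_le_mul_of_nonneg_left h4 (sq_nonneg h)
  set κ := √(1 / 2 : ℝ) with hκ
  have hκ2 : κ ^ 2 = 1 / 2 := Real.sq_sqrt (by norm_num)
  have hbh (t) : 2 * ‖b t‖ ≤ 1 := (hb2 t).trans (by linarith)
  have key := le_minimaxLength (n := n) (α := α) hα1 (Θ₀ := sparseSpace p M M₁ M₂ s)
    (Θ₁ := sparseSpace p M M₁ M₂ s₁) (T := Fin k → Fin B) (g := fun t => (2 * κ) • b t) ?_
    ?_ (φ := spikeObs h) (by fun_prop) (θ₀ := spikeParam h 0) (θ := fun t => spikeParam h (b t))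
    (δ := -(h * x / (1 - x)))
    (hmem 0 (by simp) (by simpa using hMi) (T := ∅) (by simp) (by simp; omega))
    (hmem 0 (by simp) (by simpa using hMi) (T := ∅) (by simp) (by simpa using hs₁))
    (fun t => hmem (b t) (hb0 t) (hb2 t) (hbsupp t) (le_trans (by
      gcongr
      exact Finset.card_image_le.trans (by simp)) hs))
    (by rw [obsLaw_spikeParam h (by simp) (by simp), smul_zero, regLaw_zero])
    (fun t => obsLaw_spikeParam h (hb0 t) (hbh t))
    (fun t => by
      simp [spikeParam, Param.beta, hbn, hb0]
      ring)
  · refine le_trans (ENNReal.ofReal_le_ofReal ?_) key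
    rw [abs_neg, abs_of_nonneg (div_nonneg (by positivity) (by linarith))]
    gcongr
    rw [le_div_iff₀ (by linarith)]
    nlinarith [mul_nonneg hh.le hx0]
  · intro t
    rw [← sq_lt_one_iff₀ (norm_nonneg _), norm_smul, mul_pow, hbn, Real.norm_eq_abs, sq_abs,
      mul_pow, hκ2]
    linarith
  · have h3 (t t') : inner ℝ ((2 * κ) • b t) ((2 * κ) • b t') = 2 * inner ℝ (b t) (b t') := by
      rw [real_inner_smul_left, real_inner_smul_right, ← mul_assoc, ← sq, mul_pow, hκ2]
      ring
    simp_rw [h3]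
    exact sum_affinity_blockVec_le he r hx hB

end Blocks

/-- The sparse part of the lower bound. The exponent `c < 1 / 2` leaves room for the overlap of two
random supports of size `p ^ c`. -/
lemma sparse_le_minimaxLength {M M₁ M₂ c α h : ℝ} (hM : 1 < M) (hc : c < 1 / 2)
    (hα1 : α < 1 / 4) (hh : 0 < h) (h1 : h ≤ M₁) (h2 : h ≤ M₂) :
    ∃ κ : ℝ, 0 < κ ∧ ∀ (n p s s₁ : ℕ) [NeZero p], 0 < n →
      (s : ℝ) * Real.log p / n ≤ 1 / 4 → 2 ≤ s → (s : ℝ) ≤ (p : ℝ) ^ c → 1 ≤ s₁ →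
      ENNReal.ofReal (h * κ / 8 * (s * Real.log p / n)) ≤
        minimaxLength n α (sparseSpace p M M₁ M₂ s) (sparseSpace p M M₁ M₂ s₁) := by
  set d := 1 - 2 * c with hd
  have hd0 : 0 < d := by linarith
  have hMi : M⁻¹ < 1 := inv_lt_one_of_one_lt₀ hM
  have hMp : 0 < M⁻¹ := inv_pos.2 (by linarith)
  set κ := min (d / 320) ((1 - M⁻¹) ^ 2) with hκ
  have hκ0 : 0 < κ := lt_min (by positivity) (pow_pos (by linarith) 2)
  have hκ1 : κ ≤ d / 320 := min_le_left _ _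
  have hκ2 : κ ≤ (1 - M⁻¹) ^ 2 := min_le_right _ _
  refine ⟨κ, hκ0, fun n p s s₁ _ hn hlog hs hsp hs₁ => ?_⟩
  have hn0 : (0 : ℝ) < n := by exact_mod_cast hn
  have hp1 : (1 : ℝ) ≤ p := by exact_mod_cast Nat.one_le_iff_ne_zero.2 (NeZero.ne p)
  have hp0 : (0 : ℝ) < p := by linarith
  have hs2 : (2 : ℝ) ≤ s := by exact_mod_cast hs
  have hlogp : 0 ≤ Real.log p := Real.log_nonneg hp1
  have hssq : (s : ℝ) ^ 2 ≤ (p : ℝ) ^ (2 * c) := by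
    rw [mul_comm, Real.rpow_mul hp0.le, Real.rpow_two]
    exact pow_le_pow_left₀ (by linarith) hsp 2
  have hssqp : (s : ℝ) ^ 2 ≤ p :=
    hssq.trans ((Real.rpow_le_rpow_of_exponent_le hp1 (by linarith)).trans_eq (Real.rpow_one _))
  obtain ⟨k, rfl⟩ : ∃ k, s = k + 1 := ⟨s - 1, by omega⟩
  have hk1 : 1 ≤ k := by omega
  have hk1' : (1 : ℝ) ≤ k := by exact_mod_cast hk1
  have hkp : (k + 1) ^ 2 ≤ p := by exact_mod_cast hssqp
  set B := (p - 1) / k with hBdef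
  have hBk : B * k ≤ p - 1 := Nat.div_mul_le_self _ _
  have hB0 : 0 < B := Nat.div_pos (by nlinarith [Nat.le_sub_one_of_lt (by nlinarith : k < p)]) hk1
  have hBlow : p ≤ 2 * k * B := by
    have h3 : p - 1 < (B + 1) * k := (Nat.div_lt_iff_lt_mul hk1).1 (Nat.lt_succ_self _)
    have h4 : k ≤ B * k := Nat.le_mul_of_pos_left k hB0
    have h5 : 2 * k * B = B * k + B * k := by ring
    rw [add_mul, one_mul] at h3
    omega
  have : NeZero B := ⟨hB0.ne'⟩
  set r := √(κ * Real.log p / n)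
  have hr2 : r ^ 2 = κ * Real.log p / n := Real.sq_sqrt (by positivity)
  -- The blocks consist of consecutive coordinates after the first one.
  have hlt (x : Fin k × Fin B) : (finProdFinEquiv x).val + 1 < p := by
    have h3 := (finProdFinEquiv x).isLt
    have h4 : k * B = B * k := mul_comm _ _
    have h5 : 0 < p := Nat.pos_of_ne_zero (NeZero.ne p)
    omega
  set e : Fin k × Fin B → Fin p := fun x => ⟨(finProdFinEquiv x).val + 1, hlt x⟩ with he
  have heinj : Function.Injective e := fun x y hxy =>
    finProdFinEquiv.injective (Fin.ext (Nat.succ_injective (Fin.mk.inj_iff.1 hxy)))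
  have he0 (x) : e x ≠ 0 := by
    intro h0
    have := congrArg Fin.val h0
    simp [he] at this
  push_cast at hlog hs2 hssq ⊢
  have hkr : k * r ^ 2 = κ * (k * Real.log p / n) := by rw [hr2]; ring
  have hkn : k * Real.log p / n ≤ 1 / 4 := by
    refine le_trans ?_ hlog
    gcongr
    linarith
  have key := spike_le_minimaxLength (n := n) (s := k + 1) (s₁ := s₁) heinj r he0 hM hα1 hh h1 h2
    le_rfl hs₁ ?_ ?_
  · refine le_trans (ENNReal.ofReal_le_ofReal ?_) key
    rw [hkr]
    have h3 : ((k : ℝ) + 1) * Real.log p / n ≤ 2 * (k * Real.log p / n) := by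
      rw [← mul_div_assoc, ← mul_assoc]
      gcongr
      linarith
    calc h * κ / 8 * (((k : ℝ) + 1) * Real.log p / n)
        ≤ h * κ / 8 * (2 * (k * Real.log p / n)) := by gcongr
      _ = _ := by ring
  · rw [hkr]
    calc 4 * (κ * (k * Real.log p / n)) ≤ 4 * (κ * (1 / 4)) := by gcongr
      _ = κ := by ring
      _ ≤ _ := hκ2
  · have e1 : 4 * n * r ^ 2 = 4 * κ * Real.log p := by rw [hr2]; field_simp
    rw [e1]
    -- `exp y - 1 ≤ y exp y`
    have e2 : Real.exp (4 * κ * Real.log p) - 1 ≤ 4 * κ * Real.log p * (p : ℝ) ^ (d / 2) := by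
      have h3 := Real.add_one_le_exp (-(4 * κ * Real.log p))
      have h4 : Real.exp (4 * κ * Real.log p) - 1 ≤
          4 * κ * Real.log p * Real.exp (4 * κ * Real.log p) := by
        have h5 : Real.exp (-(4 * κ * Real.log p)) * Real.exp (4 * κ * Real.log p) = 1 := by
          rw [← Real.exp_add]; simp
        nlinarith [Real.exp_pos (4 * κ * Real.log p)]
      refine h4.trans ?_
      gcongr
      rw [Real.rpow_def_of_pos hp0, mul_comm]
      gcongr
      linarith
    have e3 : Real.log p ≤ (p : ℝ) ^ (d / 2) / (d / 2) :=
      Real.log_le_rpow_div hp0.le (by positivity)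
    have e4 : (p : ℝ) ≤ 2 * k * B := by exact_mod_cast hBlow
    have hB0' : (0 : ℝ) < B := by exact_mod_cast hB0
    have e5 : (k : ℝ) / B ≤ 2 * (p : ℝ) ^ (2 * c) / p := by
      rw [div_le_div_iff₀ hB0' hp0]
      calc (k : ℝ) * p ≤ k * (2 * k * B) := by gcongr
        _ = 2 * k ^ 2 * B := by ring
        _ ≤ 2 * (p : ℝ) ^ (2 * c) * B := by
          gcongr
          refine le_trans ?_ hssq
          gcongr
          linarith
    have e6 : (p : ℝ) ^ (2 * c) / p * ((p : ℝ) ^ (d / 2) * (p : ℝ) ^ (d / 2)) = 1 := by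
      rw [← Real.rpow_add hp0, ← Real.rpow_sub_one hp0.ne', ← Real.rpow_add hp0, hd]
      ring_nf
      exact Real.rpow_zero _
    calc k * (Real.exp (4 * κ * Real.log p) - 1) / B
        = k / B * (Real.exp (4 * κ * Real.log p) - 1) := by ring
      _ ≤ (2 * (p : ℝ) ^ (2 * c) / p) * (4 * κ * Real.log p * (p : ℝ) ^ (d / 2)) := by
        refine mul_le_mul e5 e2 ?_ (by positivity)
        rw [sub_nonneg]; exact Real.one_le_exp (by positivity)
      _ ≤ (2 * (p : ℝ) ^ (2 * c) / p) *
          (4 * κ * ((p : ℝ) ^ (d / 2) / (d / 2)) * (p : ℝ) ^ (d / 2)) := by gcongr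
      _ = 16 * κ / d *
          ((p : ℝ) ^ (2 * c) / p * ((p : ℝ) ^ (d / 2) * (p : ℝ) ^ (d / 2))) := by
        field_simp; ring
      _ = 16 * κ / d := by rw [e6, mul_one]
      _ ≤ 1 / 20 := by rw [div_le_iff₀ hd0]; linarith

theorem theorem5 (M M₁ M₂ c α : ℝ) (hM : 1 < M) (hM₁ : 0 < M₁) (hM₂ : 0 < M₂)
    (hc : c < 1 / 2) (hα₀ : 0 < α) (hα₁ : α < 1 / 4) :
    ∃ c₁ c₂ : ℝ, 0 < c₁ ∧ 0 < c₂ ∧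
      ∀ (n p s s₁ : ℕ) [NeZero p],
        0 < n → (s : ℝ) * Real.log p / n ≤ 1 / 4 →
        2 ≤ s → (s : ℝ) ≤ (p : ℝ) ^ c →
        1 ≤ s₁ → (s₁ : ℝ) ≤ (s : ℝ) / 2 →
        ENNReal.ofReal (c₁ * (1 / Real.sqrt n + s * Real.log p / n)) ≤
            minimaxLength n α (sparseSpace p M M₁ M₂ s) (sparseSpace p M M₁ M₂ s₁) ∧
          minimaxLength n α (sparseSpace p M M₁ M₂ s) (sparseSpace p M M₁ M₂ s₁) ≤
            ENNReal.ofReal (c₂ * (1 / Real.sqrt n + s * Real.log p / n)) := by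
  set h := min M₁ M₂
  have hh : 0 < h := lt_min hM₁ hM₂
  obtain ⟨κ, hκ, hsparse⟩ := sparse_le_minimaxLength (M := M) (M₁ := M₁) (M₂ := M₂) (c := c)
    (α := α) hM hc hα₁ hh (min_le_left _ _) (min_le_right _ _)
  obtain ⟨C, hC, hupper⟩ := minimaxLength_le (M := M) (M₁ := M₁) (M₂ := M₂) (α := α) hM hM₂ hα₀
    (by linarith)
  refine ⟨min (h / 28) (h * κ / 8) / 2, C, by positivity, hC, ?_⟩
  intro n p s s₁ _ hn hlog hs hsp hs₁ _
  have hn0 : (0 : ℝ) < n := by exact_mod_cast hn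
  have hp1 : (1 : ℝ) ≤ p := by exact_mod_cast Nat.one_le_iff_ne_zero.2 (NeZero.ne p)
  have hs2 : (2 : ℝ) ≤ s := by exact_mod_cast hs
  -- The growth condition forces `p ≥ s ^ 2 ≥ 4`, hence `log p ≥ 1` and `n ≥ 8`.
  have hp4 : (4 : ℝ) ≤ p := by
    have h1 : (s : ℝ) ≤ √p := by
      rw [Real.sqrt_eq_rpow]
      exact hsp.trans (Real.rpow_le_rpow_of_exponent_le hp1 hc.le)
    have h2 := Real.le_sqrt' (by linarith : (0 : ℝ) < s) |>.1 h1
    nlinarith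
  have hlogp : 1 ≤ Real.log p := by
    rw [Real.le_log_iff_exp_le (by linarith)]
    linarith [Real.exp_one_lt_three]
  rw [div_le_iff₀ hn0] at hlog
  have hn8 : (8 : ℝ) ≤ n := by nlinarith
  constructor
  · rw [← div_le_iff₀ hn0] at hlog
    have a1 := parametric_le_minimaxLength (M := M) (M₁ := M₁) (M₂ := M₂) (n := n) (p := p)
      (s := s) (s₁ := s₁) hM hα₁ hh (min_le_left _ _) (min_le_right _ _) hn (by omega) hs₁
    have a2 := hsparse n p s s₁ hn hlog hs hsp hs₁
    have b1 : 0 ≤ 1 / √(n : ℝ) := by positivity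
    have b2 : 0 ≤ s * Real.log p / n := by positivity
    have d1 : min (h / 28) (h * κ / 8) * (1 / √(n : ℝ)) ≤ h / 28 * (1 / √(n : ℝ)) :=
      mul_le_mul_of_nonneg_right (min_le_left _ _) b1
    have d2 : min (h / 28) (h * κ / 8) * (s * Real.log p / n) ≤
        h * κ / 8 * (s * Real.log p / n) :=
      mul_le_mul_of_nonneg_right (min_le_right _ _) b2
    rcases le_total (h / 28 * (1 / √(n : ℝ))) (h * κ / 8 * (s * Real.log p / n)) with hle | hle
    · exact (ENNReal.ofReal_le_ofReal (by linarith)).trans a2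
    · exact (ENNReal.ofReal_le_ofReal (by linarith)).trans a1
  · refine hupper n p s s₁ (by exact_mod_cast (by linarith : (2 : ℝ) ≤ n))
      (by exact_mod_cast (by linarith : (3 : ℝ) ≤ p)) ?_
    rw [div_le_one hn0]
    nlinarith
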